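/- Let $k$ be a field of characteristic zero. Let $\mathcal{FK}_3$ be the $k$-algebra generated by $a,b,c$ subject to $a^2=b^2=c^2=0$ and $ab+bc+ca=0=ba+ac+cb$, and let $A=k\langle a,b\mid a^2,\,b^2,\,aba-bab\rangle$, augmented by $\varepsilon(a)=\varepsilon(b)=0$, with $A_+=\ker\varepsilon$. Let $E(A)=\bigoplus_n E_n(A)$ be the Yoneda (cohomology) ring of $A$: the cohomology of the normalized bar complex $\operatorname{Hom}_k(A_+^{\otimes n},k)=V^{\otimes n}$, where $V=A_+^*$, i.e. of the tensor algebra $T(V)$ with the differential determined by $\delta^1 f=-\sum f_i'\otimes f_i''$ whenever $f(\lambda_1\lambda_2)=\sum f_i'(\lambda_1)f_i''(\lambda_2)$ on $A_+\times A_+$, and $\delta(v\otimes w)=\delta^1(v)\otimes w-v\otimes\delta(w)$ for $v\in V$; the product of $E(A)$ is induced by the product of $T(V)$. Then: (0) The algebra map $A\to\mathcal{FK}_3$ with $a\mapsto a$, $b\mapsto b$ is injective, and its image is the subalgebra generated by $a$ and $b$. (1) There is an isomorphism of graded algebras $$E(A)\simeq k\langle x,y,z\mid xy,\ yx,\ zx+yz,\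 xz+zy\rangle,\qquad \deg x=\deg y=1,\ \deg z=2 .$$ (2) $\dim_k E_n(A)=n+1$ and $\dim_k \operatorname{Ext}^n_A(k,k)=n+1$ for all $n\ge 0$. (3) For $x\in A$ let $\rho_x:A\to A$ be the right multiplication by $x$. For $p,q\geq 0$ put $C_{p,q}=A$, and define $d^h_{p,q}:C_{p,q}\to C_{p-1,q}$ (for $p\ge1$) and $d^v_{p,q}:C_{p,q}\to C_{p,q-1}$ (for $q\ge1$) by - if $q\ge p$: $d^h_{p,q}=\rho_{ba}$ for $p$ odd and $\rho_{ab}$ for $p$ even; if $q<p$: $d^h_{p,q}=\rho_{-a}$ for $q$ even and $\rho_b$ for $q$ odd; - if $q>p$: $d^v_{p,q}=\rho_b$ for $p$ even and $\rho_{-a}$ for $p$ odd; if $q\le p$: $d^v_{p,q}=\rho_{ab}$ for $q$ odd and $\rho_{ba}$ for $q$ even. Then $C$ is a double complex of left $A$-modules ($d^hd^h=0$, $d^vd^v=0$, $d^hd^v+d^vd^h=0$), and its total complex, with $\operatorname{Tot}_n(C)=\bigoplus_{p+q=n}C_{p,q}$ and differential $d^h+d^v$, together with $\varepsilon:\operatorname{Tot}_0(C)=A\to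 k$, is a minimal resolution of the trivial left $A$-module $k$ by free left $A$-modules: it is exact, and the image of every differential $\operatorname{Tot}_{n+1}(C)\to\operatorname{Tot}_n(C)$ lies in $A_+\operatorname{Tot}_n(C)$. -/

import Mathlib

open scoped TensorProduct

noncomputable section

namespace YonedaFK

universe u v

section YonedaRing

/-! ### The Yoneda ring of a finite dimensional augmented algebra

`E(Λ)` is the cohomology ring of the normalized bar complex `Hom_k(Λ₊^{⊗ n}, k)`. For finite
dimensional `Λ` this DG-algebra is the tensor algebra `T(V)` on the dual `V` of `Λ₊`, the Yoneda
product being the multiplication of `T(V)`. -/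

variable {k : Type u} [Field k] {Λ : Type v} [Ring Λ] [Algebra k Λ]

/-- The augmentation ideal `Λ₊`, as a vector space. -/
abbrev Aug (ε : Λ →ₐ[k] k) : Submodule k Λ := LinearMap.ker ε.toLinearMap

/-- The multiplication `Λ₊ ⊗ Λ₊ → Λ₊`. -/
def augMul (ε : Λ →ₐ[k] k) : Aug ε ⊗[k] Aug ε →ₗ[k] Aug ε :=
  TensorProduct.lift <| LinearMap.mk₂ k
    (fun x y => ⟨x.1 * y.1, by
      have hx : ε x.1 = 0 := x.2
      change ε (x.1 * y.1) = 0
      rw [map_mul, hx, zero_mul]⟩)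
    (fun x x' y => Subtype.ext (add_mul x.1 x'.1 y.1))
    (fun c x y => Subtype.ext (smul_mul_assoc c x.1 y.1))
    (fun x y y' => Subtype.ext (mul_add x.1 y.1 y'.1))
    (fun c x y => Subtype.ext (mul_smul_comm c x.1 y.1))

/-- The tensor algebra `T(V)`, where `V` is the linear dual of `Λ₊`. -/
abbrev Bar (ε : Λ →ₐ[k] k) : Type (max u v) := TensorAlgebra k (Module.Dual k (Aug ε))

/-- The trivial left `Λ`-module `k`. -/
def trivialModule (ε : Λ →ₐ[k] k) : ModuleCat.{u} Λ :=
  (ModuleCat.restrictScalars ε.toRingHom).obj (ModuleCat.of k k)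

/-- The sign automorphism `t ↦ (-1)^{deg t} t` of `T(V)`. -/
def barSign (ε : Λ →ₐ[k] k) : Bar ε →ₐ[k] Bar ε :=
  TensorAlgebra.lift k (-TensorAlgebra.ι k)

theorem barSign_barSign (ε : Λ →ₐ[k] k) (t : Bar ε) : barSign ε (barSign ε t) = t := by
  induction t using TensorAlgebra.induction with
  | algebraMap r => simp
  | ι x => simp [barSign]
  | mul a b ha hb => rw [map_mul, map_mul, ha, hb]
  | add a b ha hb => rw [map_add, map_add, ha, hb]

variable [Module.Finite k Λ]

/-- The linear map `δ¹ : V → V ⊗ V ⊆ T(V)`: one has `δ¹ f = - ∑ fᵢ' ⊗ fᵢ''` if and only if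
`f (x * y) = ∑ fᵢ' x * fᵢ'' y` for all `x y ∈ Λ₊`. -/
def delta₁ (ε : Λ →ₐ[k] k) : Module.Dual k (Aug ε) →ₗ[k] Bar ε :=
  -(LinearMap.mul' k (Bar ε) ∘ₗ
    TensorProduct.map (TensorAlgebra.ι k) (TensorAlgebra.ι k) ∘ₗ
    (TensorProduct.dualDistribEquiv k (Aug ε) (Aug ε)).symm.toLinearMap ∘ₗ
    (augMul ε).dualMap)

theorem delta₁_eq (ε : Λ →ₐ[k] k) (f : Module.Dual k (Aug ε))
    (w : Module.Dual k (Aug ε) ⊗[k] Module.Dual k (Aug ε))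
    (h : TensorProduct.dualDistrib k (Aug ε) (Aug ε) w = f ∘ₗ augMul ε) :
    delta₁ ε f = -LinearMap.mul' k (Bar ε)
      (TensorProduct.map (TensorAlgebra.ι k) (TensorAlgebra.ι k) w) := by
  have h' : (TensorProduct.dualDistribEquiv k (Aug ε) (Aug ε)).symm ((augMul ε).dualMap f) = w := by
    rw [LinearEquiv.symm_apply_eq]
    exact h.symm
  simp only [delta₁, LinearMap.neg_apply, LinearMap.comp_apply, LinearEquiv.coe_coe, h']

/-- The algebra map `t ↦ !![(-1)^{deg t} t, δ t; 0, t]` which encodes the differential `δ`. -/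
def barMatrix (ε : Λ →ₐ[k] k) : Bar ε →ₐ[k] Matrix (Fin 2) (Fin 2) (Bar ε) :=
  TensorAlgebra.lift k
    { toFun := fun f => !![-TensorAlgebra.ι k f, delta₁ ε f; 0, TensorAlgebra.ι k f]
      map_add' := fun f g => by
        ext i j; fin_cases i <;> fin_cases j <;> simp [add_comm]
      map_smul' := fun c f => by
        ext i j; fin_cases i <;> fin_cases j <;> simp }

/-- The differential of the normalized bar complex, all degrees together. It is determined by
`delta_ι` and `delta_ι_mul` below. -/
def delta (ε : Λ →ₐ[k] k) : Bar ε →ₗ[k] Bar ε :=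
  Matrix.entryLinearMap k (Bar ε) (0 : Fin 2) (1 : Fin 2) ∘ₗ (barMatrix ε).toLinearMap

theorem barMatrix_eq (ε : Λ →ₐ[k] k) (t : Bar ε) :
    barMatrix ε t = !![barSign ε t, delta ε t; 0, t] := by
  have key : barMatrix ε t 0 0 = barSign ε t ∧ barMatrix ε t 1 0 = 0 ∧ barMatrix ε t 1 1 = t := by
    induction t using TensorAlgebra.induction with
    | algebraMap r => simp [Matrix.algebraMap_matrix_apply]
    | ι x => simp [barMatrix, barSign]
    | mul a b ha hb =>
      simp [map_mul, Matrix.mul_apply, Fin.sum_univ_two, ha.1, ha.2.1, ha.2.2,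
        hb.1, hb.2.1, hb.2.2]
    | add a b ha hb => simp [map_add, ha.1, ha.2.1, ha.2.2, hb.1, hb.2.1, hb.2.2]
  ext i j
  fin_cases i <;> fin_cases j
  · exact key.1
  · rfl
  · exact key.2.1
  · exact key.2.2

theorem delta_ι (ε : Λ →ₐ[k] k) (f : Module.Dual k (Aug ε)) :
    delta ε (TensorAlgebra.ι k f) = delta₁ ε f := by
  simp [delta, barMatrix]

theorem delta_mul (ε : Λ →ₐ[k] k) (s t : Bar ε) :
    delta ε (s * t) = delta ε s * t + barSign ε s * delta ε t := by
  have h := congrFun (congrFun (map_mul (barMatrix ε) s t) 0) 1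
  rw [barMatrix_eq, barMatrix_eq, barMatrix_eq, Matrix.mul_apply, Fin.sum_univ_two] at h
  simpa [add_comm] using h

/-- `δ = δ¹ ⊗ id - id ⊗ δ`. -/
theorem delta_ι_mul (ε : Λ →ₐ[k] k) (f : Module.Dual k (Aug ε)) (t : Bar ε) :
    delta ε (TensorAlgebra.ι k f * t) =
      delta₁ ε f * t - TensorAlgebra.ι k f * delta ε t := by
  rw [delta_mul, delta_ι, sub_eq_add_neg]
  simp [barSign]

theorem delta_algebraMap (ε : Λ →ₐ[k] k) (r : k) : delta ε (algebraMap k (Bar ε) r) = 0 := by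
  simp [delta, Matrix.algebraMap_matrix_apply]

theorem barSign_delta₁ (ε : Λ →ₐ[k] k) (f : Module.Dual k (Aug ε)) :
    barSign ε (delta₁ ε f) = delta₁ ε f := by
  have h : ∀ w : Module.Dual k (Aug ε) ⊗[k] Module.Dual k (Aug ε),
      barSign ε (LinearMap.mul' k (Bar ε)
        (TensorProduct.map (TensorAlgebra.ι k) (TensorAlgebra.ι k) w)) =
      LinearMap.mul' k (Bar ε)
        (TensorProduct.map (TensorAlgebra.ι k) (TensorAlgebra.ι k) w) := by
    intro w
    induction w using TensorProduct.induction_on with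
    | zero => simp
    | tmul x y => simp [barSign]
    | add x y hx hy => simp only [map_add, hx, hy]
  simp only [delta₁, LinearMap.neg_apply, LinearMap.comp_apply, map_neg, h]

theorem delta_barSign (ε : Λ →ₐ[k] k) (t : Bar ε) :
    delta ε (barSign ε t) = -barSign ε (delta ε t) := by
  induction t using TensorAlgebra.induction with
  | algebraMap r => simp [delta_algebraMap]
  | ι x =>
    have : barSign ε (TensorAlgebra.ι k x) = -TensorAlgebra.ι k x := by simp [barSign]
    rw [this, map_neg, delta_ι, barSign_delta₁]
  | mul a b ha hb =>
    rw [map_mul, delta_mul, delta_mul, map_add, map_mul, map_mul, ha, hb, barSign_barSign]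
    noncomm_ring
  | add a b ha hb => simp only [map_add, ha, hb, neg_add]

/-- The algebra of cocycles. -/
def cocycles (ε : Λ →ₐ[k] k) : Subalgebra k (Bar ε) where
  carrier := {t | delta ε t = 0}
  mul_mem' {s t} hs ht := by
    have hs' : delta ε s = 0 := hs
    have ht' : delta ε t = 0 := ht
    change delta ε (s * t) = 0
    rw [delta_mul, hs', ht', zero_mul, mul_zero, add_zero]
  add_mem' {s t} hs ht := by
    have hs' : delta ε s = 0 := hs
    have ht' : delta ε t = 0 := ht
    change delta ε (s + t) = 0
    rw [map_add, hs', ht', add_zero]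
  algebraMap_mem' r := delta_algebraMap ε r

/-- The ideal of coboundaries in the algebra of cocycles. -/
def coboundaries (ε : Λ →ₐ[k] k) : Ideal (cocycles ε) where
  carrier := {z | ∃ w : Bar ε, delta ε w = z}
  zero_mem' := ⟨0, by simp⟩
  add_mem' := by
    rintro _ _ ⟨v, hv⟩ ⟨w, hw⟩
    exact ⟨v + w, by rw [map_add, hv, hw]; rfl⟩
  smul_mem' := by
    rintro ⟨c, hc⟩ z ⟨w, hw⟩
    have hc' : delta ε c = 0 := hc
    refine ⟨barSign ε c * w, ?_⟩
    rw [delta_mul, delta_barSign, hc', barSign_barSign, hw]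
    simp

instance (ε : Λ →ₐ[k] k) : (coboundaries ε).IsTwoSided where
  mul_mem_of_left := by
    rintro z ⟨c, hc⟩ ⟨w, hw⟩
    have hc' : delta ε c = 0 := hc
    refine ⟨w * c, ?_⟩
    rw [delta_mul, hc', hw]
    simp

/-- The Yoneda ring `E(Λ)`. -/
abbrev YonedaRing (ε : Λ →ₐ[k] k) : Type (max u v) := cocycles ε ⧸ coboundaries ε

/-- The homogeneous component `E_n(Λ)`: the classes of the cocycles in `V^{⊗ n}`. -/
def yonedaDegree (ε : Λ →ₐ[k] k) (n : ℕ) : Submodule k (YonedaRing ε) :=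
  (((LinearMap.range (TensorAlgebra.ι k : Module.Dual k (Aug ε) →ₗ[k] Bar ε)) ^ n).comap
    (cocycles ε).val.toLinearMap).map
    (Ideal.Quotient.mkₐ k (coboundaries ε)).toLinearMap

end YonedaRing

section Algebras

variable (k : Type u) [Field k]

/-- The defining relations of `FK₃`; the generators `0, 1, 2` are `a, b, c`. -/
inductive FKRel : FreeAlgebra k (Fin 3) → FreeAlgebra k (Fin 3) → Prop
  | sq (i : Fin 3) : FKRel (FreeAlgebra.ι k i * FreeAlgebra.ι k i) 0
  | abc : FKRel (FreeAlgebra.ι k 0 * FreeAlgebra.ι k 1 + FreeAlgebra.ι k 1 * FreeAlgebra.ι k 2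
      + FreeAlgebra.ι k 2 * FreeAlgebra.ι k 0) 0
  | bac : FKRel (FreeAlgebra.ι k 1 * FreeAlgebra.ι k 0 + FreeAlgebra.ι k 0 * FreeAlgebra.ι k 2
      + FreeAlgebra.ι k 2 * FreeAlgebra.ι k 1) 0

/-- The Fomin-Kirillov algebra `FK₃`. -/
abbrev FK : Type u := RingQuot (FKRel k)

/-- The generators `a, b, c` of `FK₃`. -/
def fkGen (i : Fin 3) : FK k := RingQuot.mkAlgHom k (FKRel k) (FreeAlgebra.ι k i)

/-- The defining relations of `A = k⟨a, b | a², b², aba - bab⟩`. -/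
inductive ARel : FreeAlgebra k (Fin 2) → FreeAlgebra k (Fin 2) → Prop
  | sq (i : Fin 2) : ARel (FreeAlgebra.ι k i * FreeAlgebra.ι k i) 0
  | braid : ARel
      (FreeAlgebra.ι k 0 * FreeAlgebra.ι k 1 * FreeAlgebra.ι k 0
        - FreeAlgebra.ι k 1 * FreeAlgebra.ι k 0 * FreeAlgebra.ι k 1) 0

/-- The algebra `A = k⟨a, b | a², b², aba - bab⟩`. -/
abbrev A : Type u := RingQuot (ARel k)

/-- The generator `a` of `A`. -/
def genA : A k := RingQuot.mkAlgHom k (ARel k) (FreeAlgebra.ι k 0)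

/-- The generator `b` of `A`. -/
def genB : A k := RingQuot.mkAlgHom k (ARel k) (FreeAlgebra.ι k 1)

/-- The augmentation of `A`, with `a, b ↦ 0`. -/
def augA : A k →ₐ[k] k :=
  RingQuot.liftAlgHom k ⟨FreeAlgebra.lift k (fun _ => (0 : k)), by
    intro x y h
    cases h <;> simp⟩

theorem genA_sq : genA k * genA k = 0 := by
  simpa [genA] using RingQuot.mkAlgHom_rel k (ARel.sq (k := k) 0)

theorem genB_sq : genB k * genB k = 0 := by
  simpa [genB] using RingQuot.mkAlgHom_rel k (ARel.sq (k := k) 1)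

theorem braid : genA k * genB k * genA k = genB k * genA k * genB k := by
  have h := RingQuot.mkAlgHom_rel k (ARel.braid (k := k))
  simp only [map_sub, map_mul, map_zero] at h
  exact sub_eq_zero.mp h

instance : Module.Finite k (A k) := by
  set a := genA k with ha
  set b := genB k with hb
  have haa : a * a = 0 := genA_sq k
  have hbb : b * b = 0 := genB_sq k
  have hab : a * b * a = b * a * b := braid k
  let S : Submodule k (A k) := Submodule.span k {1, a, b, a * b, b * a, a * b * a}
  have m : ∀ x ∈ ({1, a, b, a * b, b * a, a * b * a} : Set (A k)), x ∈ S :=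
    fun x hx => Submodule.subset_span hx
  have hl : ∀ c : A k, (∀ x ∈ ({1, a, b, a * b, b * a, a * b * a} : Set (A k)), c * x ∈ S) →
      ∀ x ∈ S, c * x ∈ S := by
    intro c hc x hx
    induction hx using Submodule.span_induction with
    | mem x h => exact hc x h
    | zero => simp
    | add x y _ _ hx hy => rw [mul_add]; exact S.add_mem hx hy
    | smul r x _ hx => rw [mul_smul_comm]; exact S.smul_mem r hx
  have hA : ∀ x ∈ S, a * x ∈ S := by
    apply hl
    intro x hx
    simp only [Set.mem_insert_iff, Set.mem_singleton_iff] at hx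
    rcases hx with rfl | rfl | rfl | rfl | rfl | rfl
    · rw [mul_one]; exact m _ (by simp)
    · rw [haa]; exact S.zero_mem
    · exact m _ (by simp)
    · rw [← mul_assoc, haa, zero_mul]; exact S.zero_mem
    · rw [← mul_assoc]; exact m _ (by simp)
    · rw [← mul_assoc, ← mul_assoc, haa, zero_mul, zero_mul]; exact S.zero_mem
  have hB : ∀ x ∈ S, b * x ∈ S := by
    apply hl
    intro x hx
    simp only [Set.mem_insert_iff, Set.mem_singleton_iff] at hx
    rcases hx with rfl | rfl | rfl | rfl | rfl | rfl
    · rw [mul_one]; exact m _ (by simp)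
    · exact m _ (by simp)
    · rw [hbb]; exact S.zero_mem
    · rw [← mul_assoc, ← hab]; exact m _ (by simp)
    · rw [← mul_assoc, hbb, zero_mul]; exact S.zero_mem
    · rw [hab, ← mul_assoc, ← mul_assoc, hbb, zero_mul, zero_mul]; exact S.zero_mem
  have hw : ∀ w : FreeAlgebra k (Fin 2), ∀ x ∈ S, RingQuot.mkAlgHom k (ARel k) w * x ∈ S := by
    intro w
    induction w using FreeAlgebra.induction with
    | grade0 r =>
      intro x hx
      rw [AlgHom.commutes, ← Algebra.smul_def]; exact S.smul_mem r hx
    | grade1 i => fin_cases i; exacts [hA, hB]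
    | mul u v hu hv => intro x hx; rw [map_mul, mul_assoc]; exact hu _ (hv x hx)
    | add u v hu hv => intro x hx; rw [map_add, add_mul]; exact S.add_mem (hu x hx) (hv x hx)
  have htop : S = ⊤ := by
    refine Submodule.eq_top_iff'.mpr fun x => ?_
    obtain ⟨w, rfl⟩ := RingQuot.mkAlgHom_surjective k (ARel k) x
    simpa using hw w 1 (m _ (by simp))
  exact ⟨⟨({1, a, b, a * b, b * a, a * b * a} : Set (A k)).toFinite.toFinset, by simpa using htop⟩⟩

/-- The relations `xy, yx, zx + yz, xz + zy`; the generators `0, 1, 2` are `x, y, z`. -/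
inductive ERel : FreeAlgebra k (Fin 3) → FreeAlgebra k (Fin 3) → Prop
  | xy : ERel (FreeAlgebra.ι k 0 * FreeAlgebra.ι k 1) 0
  | yx : ERel (FreeAlgebra.ι k 1 * FreeAlgebra.ι k 0) 0
  | zx : ERel (FreeAlgebra.ι k 2 * FreeAlgebra.ι k 0 + FreeAlgebra.ι k 1 * FreeAlgebra.ι k 2) 0
  | xz : ERel (FreeAlgebra.ι k 0 * FreeAlgebra.ι k 2 + FreeAlgebra.ι k 2 * FreeAlgebra.ι k 1) 0

/-- The algebra `k⟨x, y, z | xy, yx, zx + yz, xz + zy⟩`. -/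
abbrev EPres : Type u := RingQuot (ERel k)

/-- The generators `x, y, z`. -/
def eGen (i : Fin 3) : EPres k := RingQuot.mkAlgHom k (ERel k) (FreeAlgebra.ι k i)

/-- The degrees `deg x = deg y = 1` and `deg z = 2` of the generators. -/
def eWeight : Fin 3 → ℕ := ![1, 1, 2]

/-- The homogeneous component of degree `n` of `k⟨x, y, z | xy, yx, zx + yz, xz + zy⟩`: the span
of the words of degree `n`. -/
def eDegree (n : ℕ) : Submodule k (EPres k) :=
  Submodule.span k {w | ∃ l : List (Fin 3), (l.map eWeight).sum = n ∧ (l.map (eGen k)).prod = w}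

end Algebras

section DoubleComplex

variable (k : Type u) [Field k]

/-- Right multiplication `ρ_x` by `x`, as a map of left `A`-modules. -/
def rho (x : A k) : A k →ₗ[A k] A k := LinearMap.toSpanSingleton (A k) (A k) x

/-- The horizontal map `C_{p,q} → C_{p-1,q}` (used for `1 ≤ p`), where all `C_{p,q}` are `A`. -/
def dh (p q : ℕ) : A k →ₗ[A k] A k :=
  if p ≤ q then
    if Even p then rho k (genA k * genB k) else rho k (genB k * genA k)
  else
    if Even q then rho k (-genA k) else rho k (genB k)

/-- The vertical map `C_{p,q} → C_{p,q-1}` (used for `1 ≤ q`). -/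
def dv (p q : ℕ) : A k →ₗ[A k] A k :=
  if q ≤ p then
    if Even q then rho k (genB k * genA k) else rho k (genA k * genB k)
  else
    if Even p then rho k (genB k) else rho k (-genA k)

/-- The differential `Tot_{n+1} → Tot_n` of the total complex. Here `Tot_n` is the free module
`⨁_{p + q = n} C_{p,q}`, written as `Fin (n + 1) → A`, where the index `p` stands for
`C_{p,n-p}`. -/
def totD (n : ℕ) : (Fin (n + 2) → A k) →ₗ[A k] (Fin (n + 1) → A k) :=
  LinearMap.pi fun p =>
    dh k ((p : ℕ) + 1) (n - (p : ℕ)) ∘ₗ LinearMap.proj p.succ +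
      dv k (p : ℕ) (n - (p : ℕ) + 1) ∘ₗ LinearMap.proj p.castSucc

end DoubleComplex

end YonedaFK

end

/-! The proof rests on a normal form in $A$ and on two inductions, one for the resolution and one
for the ring.

Normal form. The words $1,a,b,ab,ba,aba$ span $A$. A six-dimensional representation of $FK_3$ sends
them, applied to the first basis vector, to a basis (`coord_monA`). Hence they are a basis of $A$
and remain independent in $FK_3$, which gives the embedding and explicit coordinates for all linear
algebra in $A$.

Resolution. The shift $(p,q)\mapsto(p+1,q+1)$ changes the double complex only by the automorphism
$a\mapsto-b$, $b\mapsto-a$ (`dh_succ_succ`, `dv_succ_succ`). So the interior of a cycle of degree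
$m$ is a twisted cycle of degree $m-2$, a boundary by induction. The two corner equations can then
be solved because $\rho_a$ and $\rho_b$ have equal kernel and image (`exists_famD_eq_of_interior`).
All entries of the differential lie in $A_+$, so it dies under maps to $k$, and
$\operatorname{Ext}^n$ is $\operatorname{Hom}(\operatorname{Tot}_n,k)$, of dimension $n+1$.

Ring. This is computed inside $T(V)$, independently of the resolution. Let $l_0,\dots,l_4$ be dual
to $a,b,ab,ba,aba$. The classes $x=[l_0]$, $y=[l_1]$ and $z=[l_0l_3+l_2l_0]$ (up to sign a Massey
product $\langle x,y,x\rangle$) satisfy the relations, so the presented algebra maps to $E(A)$. In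
degree $n$ it is spanned by the $n+1$ monomials $z^{\min(p,q)}x^{p-q}y^{q-p}$, $p+q=n$, a negative
exponent being read as $0$. Writing a cochain as $\sum t_il_i$ plus a scalar turns the cocycle
condition into a triangular system (`coef_delta`), whose constraints say that certain $t_i$ become
exact after multiplication by $x$ or $y$. Independence of the monomials in degree $n+1$ tells which
combinations $x$ and $y$ kill. With spanning in degree $n$ this yields spanning in degree $n+1$
(`Spanning.succ`) and independence in degree $n+2$ (`Independent.add_two`). -/

noncomputable section

namespace YonedaFK

universe u v

/-! ### Normal form in $A$ and its embedding in $FK_3$ -/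

section AlgebraStructure

variable (k : Type u) [Field k]

/-- The action of `a, b, c` on `FK₃ / FK₃ c`, in the basis `1, a, b, ab, ba, aba`. -/
def fkOp : Fin 3 → Module.End k (Fin 6 → k) :=
  ![{ toFun := fun v => ![0, v 0, 0, v 2, 0, v 4]
      map_add' := fun v w => by ext i; fin_cases i <;> simp
      map_smul' := fun r v => by ext i; fin_cases i <;> simp },
    { toFun := fun v => ![0, 0, v 0, 0, v 1, v 3]
      map_add' := fun v w => by ext i; fin_cases i <;> simp
      map_smul' := fun r v => by ext i; fin_cases i <;> simp },
    { toFun := fun v => ![0, 0, 0, -v 1, -v 2, 0]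
      map_add' := fun v w => by ext i; fin_cases i <;> simp [add_comm]
      map_smul' := fun r v => by ext i; fin_cases i <;> simp }]

@[simp]
theorem fkOp_zero_apply (v : Fin 6 → k) : fkOp k 0 v = ![0, v 0, 0, v 2, 0, v 4] := rfl

@[simp]
theorem fkOp_one_apply (v : Fin 6 → k) : fkOp k 1 v = ![0, 0, v 0, 0, v 1, v 3] := rfl

@[simp]
theorem fkOp_two_apply (v : Fin 6 → k) : fkOp k 2 v = ![0, 0, 0, -v 1, -v 2, 0] := rfl

theorem lift_fkOp_rel {x y : FreeAlgebra k (Fin 3)} (h : FKRel k x y) :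
    FreeAlgebra.lift k (fkOp k) x = FreeAlgebra.lift k (fkOp k) y := by
  cases h with
  | sq i =>
    simp only [map_mul, FreeAlgebra.lift_ι_apply, map_zero]
    refine LinearMap.ext fun v => ?_
    fin_cases i <;> simp [Module.End.mul_apply]
  | abc =>
    simp only [map_mul, map_add, FreeAlgebra.lift_ι_apply, map_zero]
    refine LinearMap.ext fun v => ?_
    simp [Module.End.mul_apply]
  | bac =>
    simp only [map_mul, map_add, FreeAlgebra.lift_ι_apply, map_zero]
    refine LinearMap.ext fun v => ?_
    simp [Module.End.mul_apply]

/-- The representation of `FK₃` on `FK₃ / FK₃ c`. -/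
def fkRep : FK k →ₐ[k] Module.End k (Fin 6 → k) :=
  RingQuot.liftAlgHom k ⟨FreeAlgebra.lift k (fkOp k), fun _ _ h => lift_fkOp_rel k h⟩

theorem fkRep_gen (i : Fin 3) : fkRep k (fkGen k i) = fkOp k i := by
  simp [fkRep, fkGen]

theorem fkGen_sq (i : Fin 3) : fkGen k i * fkGen k i = 0 := by
  simpa [fkGen] using RingQuot.mkAlgHom_rel k (FKRel.sq (k := k) i)

theorem fkGen_bac : fkGen k 1 * fkGen k 0 + fkGen k 0 * fkGen k 2 + fkGen k 2 * fkGen k 1 = 0 := by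
  simpa [fkGen] using RingQuot.mkAlgHom_rel k (FKRel.bac (k := k))

/-- Both sides equal $-acb$: multiply $ba+ac+cb=0$ by $a$ on the left, respectively by $b$ on the
right. -/
theorem fkGen_braid :
    fkGen k 0 * fkGen k 1 * fkGen k 0 = fkGen k 1 * fkGen k 0 * fkGen k 1 := by
  have h₁ := congrArg (fkGen k 0 * ·) (fkGen_bac k)
  have h₂ := congrArg (· * fkGen k 1) (fkGen_bac k)
  simp only [add_mul, mul_add, mul_zero, zero_mul, ← mul_assoc, fkGen_sq, add_zero] at h₁ h₂
  rw [mul_assoc (fkGen k 2), fkGen_sq, mul_zero, add_zero] at h₂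
  exact (eq_neg_of_add_eq_zero_left h₁).trans (eq_neg_of_add_eq_zero_left h₂).symm

/-- The algebra map `A → FK₃` with `a ↦ a` and `b ↦ b`. -/
def toFK : A k →ₐ[k] FK k :=
  RingQuot.liftAlgHom k ⟨FreeAlgebra.lift k ![fkGen k 0, fkGen k 1], fun x y h => by
    cases h with
    | sq i => fin_cases i <;> simp [fkGen_sq]
    | braid => simp [fkGen_braid]⟩

@[simp]
theorem toFK_genA : toFK k (genA k) = fkGen k 0 := by simp [toFK, genA]

@[simp]
theorem toFK_genB : toFK k (genB k) = fkGen k 1 := by simp [toFK, genB]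

theorem adjoin_gen : Algebra.adjoin k {genA k, genB k} = ⊤ := by
  refine Algebra.eq_top_iff.mpr fun x => ?_
  obtain ⟨w, rfl⟩ := RingQuot.mkAlgHom_surjective k (ARel k) x
  induction w using FreeAlgebra.induction with
  | grade0 r => rw [AlgHom.commutes]; exact Subalgebra.algebraMap_mem _ r
  | grade1 i =>
    fin_cases i
    · exact Algebra.subset_adjoin (Set.mem_insert _ _)
    · exact Algebra.subset_adjoin (Set.mem_insert_of_mem _ rfl)
  | mul u v hu hv => rw [map_mul]; exact Subalgebra.mul_mem _ hu hv
  | add u v hu hv => rw [map_add]; exact Subalgebra.add_mem _ hu hv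

theorem range_toFK : (toFK k).range = Algebra.adjoin k {fkGen k 0, fkGen k 1} := by
  rw [← Algebra.map_top, ← adjoin_gen, AlgHom.map_adjoin, Set.image_pair, toFK_genA, toFK_genB]

/-- The monomials `1, a, b, ab, ba, aba` of `A`. -/
def monA : Fin 6 → A k :=
  ![1, genA k, genB k, genA k * genB k, genB k * genA k, genA k * genB k * genA k]

/-- The coordinates of the elements of `A` in the basis `1, a, b, ab, ba, aba`. -/
def coord : A k →ₗ[k] (Fin 6 → k) :=
  LinearMap.applyₗ (Pi.single 0 1) ∘ₗ (fkRep k).toLinearMap ∘ₗ (toFK k).toLinearMap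

theorem coord_one : coord k 1 = ![1, 0, 0, 0, 0, 0] := by
  ext i; fin_cases i <;> simp [coord]

theorem coord_genA_mul (x : A k) : coord k (genA k * x) = fkOp k 0 (coord k x) := by
  simp only [coord, LinearMap.comp_apply, AlgHom.toLinearMap_apply, map_mul, toFK_genA, fkRep_gen,
    LinearMap.applyₗ_apply_apply, Module.End.mul_apply]

theorem coord_genB_mul (x : A k) : coord k (genB k * x) = fkOp k 1 (coord k x) := by
  simp only [coord, LinearMap.comp_apply, AlgHom.toLinearMap_apply, map_mul, toFK_genB, fkRep_gen,
    LinearMap.applyₗ_apply_apply, Module.End.mul_apply]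

theorem coord_monA (i : Fin 6) : coord k (monA k i) = Pi.single i 1 := by
  have hA : coord k (genA k) = ![0, 1, 0, 0, 0, 0] := by
    rw [← mul_one (genA k), coord_genA_mul, coord_one]; simp
  have hB : coord k (genB k) = ![0, 0, 1, 0, 0, 0] := by
    rw [← mul_one (genB k), coord_genB_mul, coord_one]; simp
  fin_cases i <;> ext j <;> fin_cases j <;>
    simp [monA, coord_one, hA, hB, coord_genA_mul, coord_genB_mul, mul_assoc]

theorem monA_mul_genA (i : Fin 6) :
    monA k i * genA k = ![genA k, 0, genB k * genA k, genA k * genB k * genA k, 0, 0] i := by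
  fin_cases i <;> simp [monA, mul_assoc, genA_sq]

theorem monA_mul_genB (i : Fin 6) :
    monA k i * genB k = ![genB k, genA k * genB k, 0, 0, genA k * genB k * genA k, 0] i := by
  have h : genA k * (genB k * (genA k * genB k)) = 0 := by
    rw [← mul_assoc (genB k), ← braid, ← mul_assoc, ← mul_assoc, genA_sq, zero_mul, zero_mul]
  fin_cases i <;> simp [monA, mul_assoc, genB_sq, h]
  simpa [mul_assoc] using (braid k).symm

theorem span_monA : Submodule.span k (Set.range (monA k)) = ⊤ := by
  have hm : ∀ i, monA k i ∈ Submodule.span k (Set.range (monA k)) :=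
    fun i => Submodule.subset_span ⟨i, rfl⟩
  have key : ∀ c : A k, (∀ i, monA k i * c ∈ Submodule.span k (Set.range (monA k))) →
      ∀ x ∈ Submodule.span k (Set.range (monA k)),
        x * c ∈ Submodule.span k (Set.range (monA k)) := by
    intro c hc x hx
    induction hx using Submodule.span_induction with
    | mem x h => obtain ⟨i, rfl⟩ := h; exact hc i
    | zero => simp
    | add x y _ _ hx hy => rw [add_mul]; exact Submodule.add_mem _ hx hy
    | smul r x _ hx => rw [smul_mul_assoc]; exact Submodule.smul_mem _ r hx
  have hA := key (genA k) fun i => by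
    rw [monA_mul_genA]
    fin_cases i
    exacts [hm 1, Submodule.zero_mem _, hm 4, hm 5, Submodule.zero_mem _, Submodule.zero_mem _]
  have hB := key (genB k) fun i => by
    rw [monA_mul_genB]
    fin_cases i
    exacts [hm 2, hm 3, Submodule.zero_mem _, Submodule.zero_mem _, hm 5, Submodule.zero_mem _]
  have hw : ∀ w : FreeAlgebra k (Fin 2), ∀ x ∈ Submodule.span k (Set.range (monA k)),
      x * RingQuot.mkAlgHom k (ARel k) w ∈ Submodule.span k (Set.range (monA k)) := by
    intro w
    induction w using FreeAlgebra.induction with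
    | grade0 r =>
      intro x hx
      rw [AlgHom.commutes, ← Algebra.commutes, ← Algebra.smul_def]
      exact Submodule.smul_mem _ r hx
    | grade1 i => fin_cases i; exacts [hA, hB]
    | mul u v hu hv => intro x hx; rw [map_mul, ← mul_assoc]; exact hv _ (hu x hx)
    | add u v hu hv =>
      intro x hx; rw [map_add, mul_add]; exact Submodule.add_mem _ (hu x hx) (hv x hx)
  refine Submodule.eq_top_iff'.mpr fun x => ?_
  obtain ⟨w, rfl⟩ := RingQuot.mkAlgHom_surjective k (ARel k) x
  simpa using hw w 1 (hm 0)

theorem sum_coord_smul (x : A k) : ∑ i, coord k x i • monA k i = x := by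
  have hx : x ∈ Submodule.span k (Set.range (monA k)) := by rw [span_monA]; trivial
  obtain ⟨c, rfl⟩ := (Submodule.mem_span_range_iff_exists_fun k).mp hx
  refine Finset.sum_congr rfl fun i _ => ?_
  congr 1
  simp [map_sum, coord_monA, Finset.sum_apply, Pi.single_apply]

theorem coord_injective : Function.Injective (coord k) := by
  intro x y h
  rw [← sum_coord_smul k x, ← sum_coord_smul k y, h]

/-- The coordinates are read off in a representation of $FK_3$, so they factor through this map, and
they already separate elements of $A$. -/
theorem toFK_injective : Function.Injective (toFK k) := by
  intro x y h
  apply coord_injective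
  simp [coord, h]

theorem coord_sum (c : Fin 6 → k) : coord k (∑ i, c i • monA k i) = c := by
  ext j
  simp [map_sum, coord_monA, Finset.sum_apply, Pi.single_apply]

theorem coord_mul_genA (x : A k) :
    coord k (x * genA k) = ![0, coord k x 0, 0, 0, coord k x 2, coord k x 3] := by
  conv_lhs => rw [← sum_coord_smul k x]
  rw [Finset.sum_mul]
  have : ∀ i, (coord k x i • monA k i) * genA k =
      coord k x i • (![monA k 1, 0, monA k 4, monA k 5, 0, 0] i) := by
    intro i
    rw [smul_mul_assoc, monA_mul_genA]; rfl
  simp only [this, map_sum, map_smul]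
  ext j
  fin_cases j <;> simp [Fin.sum_univ_succ, coord_monA]

theorem coord_mul_genB (x : A k) :
    coord k (x * genB k) = ![0, 0, coord k x 0, coord k x 1, 0, coord k x 4] := by
  conv_lhs => rw [← sum_coord_smul k x]
  rw [Finset.sum_mul]
  have : ∀ i, (coord k x i • monA k i) * genB k =
      coord k x i • (![monA k 2, monA k 3, 0, 0, monA k 5, 0] i) := by
    intro i
    rw [smul_mul_assoc, monA_mul_genB]; rfl
  simp only [this, map_sum, map_smul]
  ext j
  fin_cases j <;> simp [Fin.sum_univ_succ, coord_monA]

@[simp]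
theorem augA_genA : augA k (genA k) = 0 := by simp [augA, genA]

@[simp]
theorem augA_genB : augA k (genB k) = 0 := by simp [augA, genB]

theorem augA_eq (x : A k) : augA k x = coord k x 0 := by
  conv_lhs => rw [← sum_coord_smul k x]
  simp [Fin.sum_univ_succ, monA]

end AlgebraStructure

/-! ### The double complex and exactness of its total complex -/

section Resolution

variable (k : Type u) [Field k]

@[simp]
theorem A.neg_mul (x y : A k) : -x * y = -(x * y) := _root_.neg_mul x y

@[simp]
theorem A.mul_neg (x y : A k) : x * -y = -(x * y) := _root_.mul_neg x y

@[simp]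
theorem rho_apply (x y : A k) : rho k x y = y * x := rfl

theorem genA_mul_genA_mul (x : A k) : genA k * (genA k * x) = 0 := by
  rw [← mul_assoc, genA_sq, zero_mul]

theorem genB_mul_genB_mul (x : A k) : genB k * (genB k * x) = 0 := by
  rw [← mul_assoc, genB_sq, zero_mul]

theorem braid_assoc : genB k * (genA k * genB k) = genA k * (genB k * genA k) := by
  rw [← mul_assoc, ← mul_assoc, braid]

theorem dh_comp_dh (p q : ℕ) : dh k (p + 1) q ∘ₗ dh k (p + 2) q = 0 := by
  refine LinearMap.ext fun x => ?_
  simp only [dh, LinearMap.comp_apply, LinearMap.zero_apply]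
  split_ifs <;> first
    | (exfalso; grind)
    | simp [mul_assoc, genA_sq, genB_sq, genA_mul_genA_mul, genB_mul_genB_mul]

theorem dv_comp_dv (p q : ℕ) : dv k p (q + 1) ∘ₗ dv k p (q + 2) = 0 := by
  refine LinearMap.ext fun x => ?_
  simp only [dv, LinearMap.comp_apply, LinearMap.zero_apply]
  split_ifs <;> first
    | (exfalso; grind)
    | simp [mul_assoc, genA_sq, genB_sq, genA_mul_genA_mul, genB_mul_genB_mul]

theorem dh_comp_dv_add (p q : ℕ) : dh k (p + 1) q ∘ₗ dv k (p + 1) (q + 1) +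
    dv k p (q + 1) ∘ₗ dh k (p + 1) (q + 1) = 0 := by
  refine LinearMap.ext fun x => ?_
  simp only [dh, dv, LinearMap.comp_apply, LinearMap.add_apply, LinearMap.zero_apply]
  split_ifs <;> first
    | (exfalso; grind)
    | simp [mul_assoc, braid_assoc]

/-- The automorphism `a ↦ -b`, `b ↦ -a` of `A`. -/
def swapNeg : A k →ₐ[k] A k :=
  RingQuot.liftAlgHom k ⟨FreeAlgebra.lift k ![-genB k, -genA k], fun x y h => by
    cases h with
    | sq i => fin_cases i <;> simp [genA_sq, genB_sq]
    | braid => simp [mul_assoc, braid_assoc]⟩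

@[simp]
theorem swapNeg_genA : swapNeg k (genA k) = -genB k := by simp [swapNeg, genA]

@[simp]
theorem swapNeg_genB : swapNeg k (genB k) = -genA k := by simp [swapNeg, genB]

@[simp]
theorem swapNeg_swapNeg (x : A k) : swapNeg k (swapNeg k x) = x := by
  have h : (swapNeg k).comp (swapNeg k) = AlgHom.id k (A k) := by
    refine AlgHom.ext_of_adjoin_eq_top (adjoin_gen k) ?_
    rintro x (rfl | rfl) <;> simp
  exact DFunLike.congr_fun h x

theorem augA_swapNeg (x : A k) : augA k (swapNeg k x) = augA k x := by
  have h : (augA k).comp (swapNeg k) = augA k := by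
    refine AlgHom.ext_of_adjoin_eq_top (adjoin_gen k) ?_
    rintro x (rfl | rfl) <;> simp
  exact DFunLike.congr_fun h x

/-- A diagonal shift keeps the comparison of $p$ with $q$ and flips both parities, which exchanges
$-a\leftrightarrow b$ and $ab\leftrightarrow ba$. The twist does exactly the same. -/
theorem dh_succ_succ (p q : ℕ) (x : A k) :
    dh k (p + 1) (q + 1) (swapNeg k x) = swapNeg k (dh k p q x) := by
  simp only [dh]
  split_ifs <;> first
    | (exfalso; grind)
    | simp

theorem dv_succ_succ (p q : ℕ) (x : A k) :
    dv k (p + 1) (q + 1) (swapNeg k x) = swapNeg k (dv k p q x) := by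
  simp only [dv]
  split_ifs <;> first
    | (exfalso; grind)
    | simp

/-- The differential of the total complex, on families indexed by all `p, q`. -/
def famD (w : ℕ → ℕ → A k) (p q : ℕ) : A k :=
  dh k (p + 1) q (w (p + 1) q) + dv k p (q + 1) (w p (q + 1))

theorem famD_succ_succ (w : ℕ → ℕ → A k) (p q : ℕ) :
    famD k w (p + 1) (q + 1) =
      swapNeg k (famD k (fun p q => swapNeg k (w (p + 1) (q + 1))) p q) := by
  simp [famD, ← dh_succ_succ, ← dv_succ_succ]

/-- Right multiplication by $a$ carries $1,b,ab$ to $a,ba,aba$ and kills the latter three, so its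
kernel is its image. The witness inverts this bijection of basis elements. -/
theorem exists_mul_genA {x : A k} (h : x * genA k = 0) : ∃ u, u * genA k = x := by
  have h' := congrArg (coord k) h
  rw [coord_mul_genA, map_zero] at h'
  have h0 := congrFun h' 1
  have h2 := congrFun h' 4
  have h3 := congrFun h' 5
  simp at h0 h2 h3
  refine ⟨∑ i, ![coord k x 1, 0, coord k x 4, coord k x 5, 0, 0] i • monA k i, ?_⟩
  apply coord_injective
  rw [coord_mul_genA, coord_sum]
  ext j
  fin_cases j <;> simp [h0, h2, h3]

theorem exists_mul_genB {x : A k} (h : x * genB k = 0) : ∃ u, u * genB k = x := by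
  have h' := congrArg (coord k) h
  rw [coord_mul_genB, map_zero] at h'
  have h0 := congrFun h' 2
  have h2 := congrFun h' 3
  have h3 := congrFun h' 5
  simp at h0 h2 h3
  refine ⟨∑ i, ![coord k x 2, coord k x 3, 0, 0, coord k x 5, 0] i • monA k i, ?_⟩
  apply coord_injective
  rw [coord_mul_genB, coord_sum]
  ext j
  fin_cases j <;> simp [h0, h2, h3]

theorem exists_mul_genA_add_mul_genB {x : A k} (h : augA k x = 0) :
    ∃ u v, u * genA k + v * genB k = x := by
  rw [augA_eq] at h
  refine ⟨∑ i, ![coord k x 1, 0, coord k x 4, coord k x 5, 0, 0] i • monA k i,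
    ∑ i, ![coord k x 2, coord k x 3, 0, 0, 0, 0] i • monA k i, ?_⟩
  apply coord_injective
  rw [map_add, coord_mul_genA, coord_mul_genB, coord_sum, coord_sum]
  ext j
  fin_cases j <;> simp [h]

/-- Compare coefficients of $ab$: no element of $Aa$ has one, while on the left it is
$\varepsilon(r)$. -/
theorem augA_eq_zero_of_mul {r u : A k} (h : r * (genA k * genB k) = u * genA k) :
    augA k r = 0 := by
  have h' := congrFun (congrArg (coord k) h) 3
  rw [← mul_assoc, coord_mul_genB, coord_mul_genA, coord_mul_genA] at h'
  simpa [augA_eq] using h'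

/-- This is exactness at $\operatorname{Tot}_1$. The equation leaves in $x$ only $ab$ besides $Aa$,
and in $y$ only $ba$ besides $Ab$. These two terms have the same coefficient, since both multiply to
$aba$; that coefficient is $r$. -/
theorem exists_of_mul_genA_eq_mul_genB {x y : A k} (h : x * genA k = y * genB k) :
    ∃ r u v, r * (genA k * genB k) + u * genA k = x ∧ r * (genB k * genA k) + v * genB k = y := by
  have h' := congrArg (coord k) h
  rw [coord_mul_genA, coord_mul_genB] at h'
  have h1 := congrFun h' 1
  have h2 := congrFun h' 2
  have h3 := congrFun h' 3
  have h4 := congrFun h' 4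
  have h5 := congrFun h' 5
  simp at h1 h2 h3 h4 h5
  refine ⟨coord k x 3 • 1,
    ∑ i, ![coord k x 1, 0, coord k x 4, coord k x 5, 0, 0] i • monA k i,
    ∑ i, ![coord k y 2, coord k y 3, 0, 0, coord k y 5, 0] i • monA k i, ?_, ?_⟩
  · apply coord_injective
    rw [map_add, smul_mul_assoc, map_smul, one_mul, coord_mul_genA, coord_sum,
      show genA k * genB k = monA k 3 from rfl, coord_monA]
    ext j
    fin_cases j <;> simp [h1, h4]
  · apply coord_injective
    rw [map_add, smul_mul_assoc, map_smul, one_mul, coord_mul_genB, coord_sum,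
      show genB k * genA k = monA k 4 from rfl, coord_monA]
    ext j
    fin_cases j <;> simp [← h2, ← h3, h5]

theorem famD_famD (w : ℕ → ℕ → A k) (p q : ℕ) : famD k (famD k w) p q = 0 := by
  have h₁ := LinearMap.congr_fun (dh_comp_dh k p q) (w (p + 2) q)
  have h₂ := LinearMap.congr_fun (dv_comp_dv k p q) (w p (q + 2))
  have h₃ := LinearMap.congr_fun (dh_comp_dv_add k p q) (w (p + 1) (q + 1))
  simp only [LinearMap.comp_apply, LinearMap.zero_apply, LinearMap.add_apply] at h₁ h₂ h₃
  simp only [famD, map_add]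
  rw [h₁, h₂, zero_add, add_zero, h₃]

theorem augA_famD (w : ℕ → ℕ → A k) (p q : ℕ) : augA k (famD k w p q) = 0 := by
  simp only [famD, dh, dv]
  split_ifs <;> simp

theorem dh_succ_zero (p : ℕ) (x : A k) : dh k (p + 1) 0 x = -(x * genA k) := by
  simp [dh]

theorem dv_zero_succ (q : ℕ) (x : A k) : dv k 0 (q + 1) x = x * genB k := by
  simp [dv]

/-- Solves `D u = w` on an antidiagonal when it is solved in the interior. -/
theorem exists_famD_eq_of_interior {n : ℕ} (hn : 1 ≤ n) (w u : ℕ → ℕ → A k)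
    (hw : ∀ p q, p + q = n → famD k w p q = 0)
    (hu : ∀ p q, p + q + 1 = n → famD k u (p + 1) (q + 1) = w (p + 1) (q + 1)) :
    ∃ u, ∀ p q, p + q = n + 1 → famD k u p q = w p q := by
  obtain ⟨m, rfl⟩ : ∃ m, n = m + 1 := ⟨n - 1, by omega⟩
  -- Substitute the interior solution for the neighbour $w_{m+1,1}$ in the cycle equation at
  -- $(m+1,0)$; anticommutativity then makes the corner defect a $\rho_a$-cycle.
  have hr : (w (m + 2) 0 - dv k (m + 2) 1 (u (m + 2) 1)) * genA k = 0 := by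
    have h₁ := hw (m + 1) 0 rfl
    have h₂ := hu m 0 rfl
    have h₃ := LinearMap.congr_fun (dv_comp_dv k (m + 1) 0) (u (m + 1) 2)
    have h₄ := LinearMap.congr_fun (dh_comp_dv_add k (m + 1) 0) (u (m + 2) 1)
    simp only [LinearMap.comp_apply, LinearMap.zero_apply, LinearMap.add_apply, zero_add,
      famD] at h₁ h₂ h₃ h₄
    rw [← h₂, map_add, h₃, add_zero] at h₁
    rw [← neg_eq_zero, ← dh_succ_zero k (m + 1), map_sub, sub_eq_zero]
    exact (eq_neg_of_add_eq_zero_left h₁).trans (eq_neg_of_add_eq_zero_left h₄).symm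
  have hs : (w 0 (m + 2) - dh k 1 (m + 2) (u 1 (m + 2))) * genB k = 0 := by
    have h₁ := hw 0 (m + 1) (by omega)
    have h₂ := hu 0 m (by omega)
    have h₃ := LinearMap.congr_fun (dh_comp_dh k 0 (m + 1)) (u 2 (m + 1))
    have h₄ := LinearMap.congr_fun (dh_comp_dv_add k 0 (m + 1)) (u 1 (m + 2))
    simp only [LinearMap.comp_apply, LinearMap.zero_apply, LinearMap.add_apply, zero_add,
      famD] at h₁ h₂ h₃ h₄
    rw [← h₂, map_add, h₃, zero_add] at h₁
    rw [← dv_zero_succ k (m + 1), map_sub, sub_eq_zero]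
    exact (eq_neg_of_add_eq_zero_right h₁).trans (eq_neg_of_add_eq_zero_right h₄).symm
  obtain ⟨r, hr⟩ := exists_mul_genA k hr
  obtain ⟨s, hs⟩ := exists_mul_genB k hs
  -- Interior equations read only entries with $p,q\ge1$, so the axes can be reset freely. The sign
  -- of $r$ compensates $\rho_{-a}$.
  refine ⟨fun p q => if q = 0 then -r else if p = 0 then s else u p q, fun p q hpq => ?_⟩
  rcases p with _ | p
  · obtain rfl : q = m + 2 := by omega
    simp only [famD]
    rw [dv_zero_succ]
    simp [hs]
  · rcases q with _ | q
    · obtain rfl : p = m + 1 := by omega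
      simp only [famD]
      rw [dh_succ_zero]
      simp [hr]
    · rw [← hu p q (by omega)]
      simp [famD]

theorem exists_famD_eq_zero_zero {x : A k} (hx : augA k x = 0) : ∃ u, famD k u 0 0 = x := by
  obtain ⟨u, v, h⟩ := exists_mul_genA_add_mul_genB k hx
  refine ⟨fun p _ => if p = 0 then v else -u, ?_⟩
  simp only [famD]
  rw [dh_succ_zero, dv_zero_succ]
  simp [h]

/-- The step is by two because the diagonal shift lowers the total degree by two. On the first
antidiagonal there is no interior; on the second it is the single entry at $(1,1)$. -/
theorem exists_famD_eq (n : ℕ) : ∀ w : ℕ → ℕ → A k,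
    (∀ p q, p + q = n → famD k w p q = 0) →
    ∃ u, ∀ p q, p + q = n + 1 → famD k u p q = w p q := by
  induction n using Nat.twoStepInduction with
  | zero =>
    intro w hw
    have h := hw 0 0 rfl
    simp only [famD] at h
    rw [dh_succ_zero, dv_zero_succ, neg_add_eq_zero] at h
    obtain ⟨r, u, v, hx, hy⟩ := exists_of_mul_genA_eq_mul_genB k h
    refine ⟨fun p q => if p = 0 then v else if q = 0 then -u else r, fun p q hpq => ?_⟩
    obtain ⟨rfl, rfl⟩ | ⟨rfl, rfl⟩ : (p = 0 ∧ q = 1) ∨ (p = 1 ∧ q = 0) := by omega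
    · rw [← hy, famD, dv_zero_succ]
      simp [dh]
    · rw [← hx, famD, dh_succ_zero]
      simp [dv, add_comm]
  | one =>
    intro w hw
    have h := hw 1 0 rfl
    simp only [famD] at h
    rw [dh_succ_zero, neg_add_eq_zero] at h
    -- The vertical map out of $C_{1,1}$ is $\rho_{ab}$, so the cycle equation at $(1,0)$ forces the
    -- augmentation to vanish.
    have hε : augA k (w 1 1) = 0 := by
      refine augA_eq_zero_of_mul k (u := w 2 0) ?_
      rw [h]
      simp [dv]
    obtain ⟨u, hu⟩ := exists_famD_eq_zero_zero k (x := swapNeg k (w 1 1))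
      ((augA_swapNeg k _).trans hε)
    -- The truncated subtractions are harmless: only values at $p,q\ge1$ matter.
    refine exists_famD_eq_of_interior k le_rfl w
      (fun p q => swapNeg k (u (p - 1) (q - 1))) hw fun p q hpq => ?_
    obtain ⟨rfl, rfl⟩ : p = 0 ∧ q = 0 := by omega
    rw [famD_succ_succ]
    simp [hu]
  | more n ih _ =>
    intro w hw
    obtain ⟨u, hu⟩ := ih (fun p q => swapNeg k (w (p + 1) (q + 1))) fun p q hpq => by
      have := hw (p + 1) (q + 1) (by omega)
      rw [famD_succ_succ] at this
      rw [← swapNeg_swapNeg k (famD k _ p q), this, map_zero]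
    refine exists_famD_eq_of_interior k (by omega) w
      (fun p q => swapNeg k (u (p - 1) (q - 1))) hw fun p q hpq => ?_
    rw [famD_succ_succ]
    simp [hu p q (by omega)]

/-- The family on the antidiagonal `p + q = n` given by an element of `Tot_n`. -/
def toFam {n : ℕ} (w : Fin (n + 1) → A k) (p _q : ℕ) : A k :=
  if h : p < n + 1 then w ⟨p, h⟩ else 0

/-- Only values on one antidiagonal enter, so any extension to a family indexed by all $p,q$ will
do. -/
theorem totD_apply (n : ℕ) (w : Fin (n + 2) → A k) (W : ℕ → ℕ → A k)
    (hW : ∀ (p : Fin (n + 2)), W p (n + 1 - p) = w p) (p : Fin (n + 1)) :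
    totD k n w p = famD k W p (n - p) := by
  have h₁ := hW p.succ
  have h₂ := hW p.castSucc
  have hp : n + 1 - (p : ℕ) = n - p + 1 := by omega
  simp only [Fin.val_succ, Fin.val_castSucc, hp, Nat.add_sub_add_right] at h₁ h₂
  simp [totD, famD, h₁, h₂]

theorem totD_eq_famD (n : ℕ) (w : Fin (n + 2) → A k) (p : Fin (n + 1)) :
    totD k n w p = famD k (toFam k w) p (n - p) :=
  totD_apply k n w _ (fun p => dif_pos p.2) p

theorem augA_totD (n : ℕ) (w : Fin (n + 2) → A k) (p : Fin (n + 1)) :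
    augA k (totD k n w p) = 0 := by
  rw [totD_eq_famD, augA_famD]

theorem totD_exact_succ (n : ℕ) : Function.Exact (totD k (n + 1)) (totD k n) := by
  intro w
  constructor
  · intro h
    obtain ⟨u, hu⟩ := exists_famD_eq k n (toFam k w) fun p q hpq => by
      have := congrFun h ⟨p, by omega⟩
      rw [totD_eq_famD] at this
      simpa [← hpq] using this
    refine ⟨fun p => u p (n + 2 - p), ?_⟩
    funext p
    rw [totD_apply k (n + 1) _ u (fun p => rfl), hu _ _ (by omega)]
    exact dif_pos p.2
  · rintro ⟨u, rfl⟩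
    funext p
    rw [totD_apply k n _ (famD k (toFam k u)) (fun p => (totD_eq_famD k (n + 1) u p).symm),
      famD_famD]
    rfl

theorem totD_exact_zero :
    Function.Exact (totD k 0) (fun w : Fin 1 → A k => augA k (w 0)) := by
  intro w
  constructor
  · intro h
    obtain ⟨u, hu⟩ := exists_famD_eq_zero_zero k h
    refine ⟨fun p => u p (1 - p), ?_⟩
    funext p
    rw [totD_apply k 0 _ u (fun p => rfl)]
    fin_cases p
    exact hu
  · rintro ⟨u, rfl⟩
    exact augA_totD k 0 u 0

theorem augA_zero_surjective :
    Function.Surjective (fun w : Fin 1 → A k => augA k (w 0)) :=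
  fun r => ⟨fun _ => algebraMap k (A k) r, by simp⟩

end Resolution

/-! ### $\operatorname{Ext}$ from the minimal resolution -/

section Ext

open CategoryTheory

variable (k : Type u) [Field k]

/-- The total complex of the double complex. -/
def totComplex : ChainComplex (ModuleCat.{u} (A k)) ℕ :=
  ChainComplex.of (fun n => ModuleCat.of (A k) (Fin (n + 1) → A k))
    (fun n => ModuleCat.ofHom (totD k n)) fun n => by
      ext1
      exact LinearMap.ext fun w => (totD_exact_succ k n).apply_apply_eq_zero w

theorem totComplex_d (n : ℕ) : (totComplex k).d (n + 1) n = ModuleCat.ofHom (totD k n) := 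
  ChainComplex.of_d (fun n => ModuleCat.of (A k) (Fin (n + 1) → A k))
    (fun n => ModuleCat.ofHom (totD k n)) n

/-- The augmentation `Tot_0 → k`. -/
def totAug : ModuleCat.of (A k) (Fin 1 → A k) ⟶ trivialModule (augA k) :=
  ModuleCat.ofHom (Y := trivialModule (augA k))
    { toFun := fun w => (augA k (w 0) : k)
      map_add' := fun _ _ => map_add (augA k) _ _
      map_smul' := fun _ _ => map_mul (augA k) _ _ }

theorem totComplex_exactAt_succ (n : ℕ) : (totComplex k).ExactAt (n + 1) := by
  rw [HomologicalComplex.exactAt_iff' _ (n + 1 + 1) (n + 1) n (by simp) (by simp)]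
  rw [ShortComplex.moduleCat_exact_iff_range_eq_ker]
  have h := LinearMap.exact_iff.mp (totD_exact_succ k n)
  change LinearMap.range ((totComplex k).d (n + 2) (n + 1)).hom =
    LinearMap.ker ((totComplex k).d (n + 1) n).hom
  rw [totComplex_d, totComplex_d]
  exact h.symm

theorem totD_totAug : (totComplex k).d 1 0 ≫ totAug k = 0 := by
  rw [totComplex_d]
  ext1
  exact LinearMap.ext fun w => (totD_exact_zero k).apply_apply_eq_zero w

instance (n : ℕ) : Projective ((totComplex k).X n) :=
  inferInstanceAs (Projective (ModuleCat.of (A k) (Fin (n + 1) → A k)))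

/-- The beginning of the total complex, with its augmentation. -/
def totShortComplex : ShortComplex (ModuleCat.{u} (A k)) :=
  ShortComplex.mk _ _ (totD_totAug k)

theorem totShortComplex_exact : (totShortComplex k).Exact := by
  rw [ShortComplex.moduleCat_exact_iff]
  intro w hw
  obtain ⟨u, hu⟩ := (totD_exact_zero k w).mp hw
  refine ⟨u, ?_⟩
  change ((totComplex k).d 1 0).hom u = w
  rw [totComplex_d]
  exact hu

instance : Epi (totAug k) :=
  (ModuleCat.epi_iff_surjective _).mpr (augA_zero_surjective k)

/-- The augmentation of the total complex. -/
def totπ : totComplex k ⟶ (ChainComplex.single₀ _).obj (trivialModule (augA k)) :=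
  (ChainComplex.toSingle₀Equiv _ _).symm ⟨totAug k, totD_totAug k⟩

theorem totπ_f_zero : (totπ k).f 0 = totAug k :=
  ChainComplex.toSingle₀Equiv_symm_apply_f_zero _ _

/-- The total complex as a projective resolution of the trivial module. -/
def totResolution : ProjectiveResolution (trivialModule (augA k)) where
  complex := totComplex k
  π := totπ k
  quasiIso := ⟨fun n => by
    cases n
    -- In degree $0$ a quasi-isomorphism onto $k$ means that
    -- $\operatorname{Tot}_1\to\operatorname{Tot}_0\to k$ is exact with epimorphic last map.
    · rw [ChainComplex.quasiIsoAt₀_iff, ShortComplex.quasiIso_iff_of_zeros']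
      · refine (ShortComplex.exact_and_epi_g_iff_of_iso (S₂ := totShortComplex k) ?_).2
          ⟨totShortComplex_exact k, inferInstanceAs (Epi (totAug k))⟩
        exact ShortComplex.isoMk (Iso.refl _) (Iso.refl _) (Iso.refl _)
          ((Category.id_comp _).trans (Category.comp_id _).symm)
          ((Category.id_comp _).trans (Eq.trans (b := totAug k) rfl (Eq.trans
            (b := (totπ k).f 0) (totπ_f_zero k).symm (Category.comp_id _).symm)))
      all_goals rfl
    · rw [quasiIsoAt_iff_exactAt']
      · apply totComplex_exactAt_succ
      · apply ChainComplex.exactAt_succ_single_obj⟩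

theorem hom_trivialModule_apply {n : ℕ}
    (f : ModuleCat.of (A k) (Fin (n + 1) → A k) ⟶ trivialModule (augA k))
    (w : Fin (n + 1) → A k) :
    f.hom w = (∑ i, augA k (w i) * id (α := k) (f.hom (Pi.single i 1)) : k) := by
  have hw : w = ∑ i, w i • (Pi.single i 1 : Fin (n + 1) → A k) := by
    funext j
    simp [Finset.sum_apply, Pi.single_apply]
  conv_lhs => rw [hw, map_sum]
  exact Finset.sum_congr rfl fun i _ => map_smul f.hom _ _

/-- A map to $k$ sees an element of a free module only through the augmentations of its coordinates,
and minimality makes these zero on boundaries. -/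
theorem totComplex_d_comp (n : ℕ) (f : (totComplex k).X n ⟶ trivialModule (augA k)) :
    (totComplex k).d (n + 1) n ≫ f = 0 := by
  rw [totComplex_d]
  ext1
  refine LinearMap.ext fun w => ?_
  refine (hom_trivialModule_apply k f (totD k n w)).trans ?_
  exact Finset.sum_eq_zero fun i _ => mul_eq_zero_of_left (augA_totD k n w i) _

open ModuleCat in
/-- Maps from a free module to the trivial module. -/
def homTrivialModuleEquiv (n : ℕ) :
    (ModuleCat.of (A k) (Fin (n + 1) → A k) ⟶ trivialModule (augA k)) ≃ₗ[k] (Fin (n + 1) → k) :=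
  LinearEquiv.ofBijective
    { toFun := fun f i => id (α := k) (f.hom (Pi.single i 1))
      map_add' := fun _ _ => rfl
      map_smul' := fun c f => by
        funext i
        change augA k (algebraMap k (A k) c) * id (α := k) (f.hom (Pi.single i 1)) = _
        rw [AlgHom.commutes]
        rfl }
    ⟨fun f g h => by
      ext1
      refine LinearMap.ext fun w => ?_
      refine (hom_trivialModule_apply k f w).trans
        (Eq.trans ?_ (hom_trivialModule_apply k g w).symm)
      exact Finset.sum_congr rfl fun i _ => congrArg _ (congrFun h i),
     fun c => ⟨ModuleCat.ofHom (Y := trivialModule (augA k))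
        { toFun := fun w => (∑ i, augA k (w i) * c i : k)
          map_add' := fun v w => by
            change (∑ i, augA k (v i + w i) * c i : k) =
              (∑ i, augA k (v i) * c i : k) + (∑ i, augA k (w i) * c i : k)
            simp [add_mul, Finset.sum_add_distrib]
          map_smul' := fun r w => by
            change (∑ i, augA k (r * w i) * c i : k) = augA k r * (∑ i, augA k (w i) * c i : k)
            simp [Finset.mul_sum, mul_assoc] }, by
      funext i
      change (∑ j, augA k ((Pi.single i 1 : Fin (n + 1) → A k) j) * c j : k) = _
      simp [Pi.single_apply, apply_ite]⟩⟩

/-! ### $\operatorname{Ext}$ when the Hom complex has zero differential -/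

section Minimal

open Abelian CochainComplex.HomComplex

universe w t

variable {C : Type u} [Category.{v} C] [Abelian C] [HasExt.{w} C] {X Y : C}
  (P : ProjectiveResolution X)

/-- The bottom degree is treated apart: a coboundary there factors through cohomological degree $1$
of the resolution, which is zero. -/
theorem extMk_zero_eq_zero (f : P.complex.X 0 ⟶ Y) (hf : P.complex.d 1 0 ≫ f = 0)
    (h : P.extMk f 1 rfl hf = 0) : f = 0 := by
  rw [← P.extEquivCohomologyClass.apply_eq_iff_eq, P.extEquivCohomologyClass_extMk,
    P.extEquivCohomologyClass_zero, CohomologyClass.mk_eq_zero_iff,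
    Cocycle.toSingleMk_mem_coboundaries_iff _ _ _ _ _ 1 (by lia)] at h
  obtain ⟨g, hg⟩ := h
  have hg0 : g = 0 :=
    (CochainComplex.isZero_of_isStrictlyLE P.cochainComplex 0 1 (by lia)).eq_of_src _ _
  rw [hg0, Limits.comp_zero] at hg
  exact (cancel_epi (P.cochainComplexXIso (-(0 : ℕ)) 0 rfl).hom).mp
    (hg.symm.trans Limits.comp_zero.symm)

/-- `Extⁿ(X, Y)` as the maps `P_n → Y`, for a projective resolution `P` of `X` whose differentials
vanish after composition with maps to `Y`. -/
def homEquivExt (R : Type t) [Ring R] [Linear R C]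
    (hP : ∀ (n : ℕ) (f : P.complex.X n ⟶ Y), P.complex.d (n + 1) n ≫ f = 0) (n : ℕ) :
    (P.complex.X n ⟶ Y) ≃ₗ[R] Ext X Y n :=
  LinearEquiv.ofBijective
    { toFun := fun f => P.extMk f (n + 1) rfl (hP n f)
      map_add' := fun f g => (P.add_extMk f g _ _ _ _).symm
      map_smul' := fun c f => by
        rw [RingHom.id_apply, Ext.smul_eq_comp_mk₀, ProjectiveResolution.extMk_comp_mk₀]
        congr 1
        simp }
    ⟨(injective_iff_map_eq_zero _).mpr fun f hf => by
      rcases n with _ | n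
      · exact extMk_zero_eq_zero P f (hP 0 f) hf
      · obtain ⟨g, rfl⟩ := (P.extMk_eq_zero_iff f _ rfl (hP _ f) n rfl).mp hf
        exact hP n g,
     fun α => by
      obtain ⟨f, hf, rfl⟩ := P.extMk_surjective α (n + 1) rfl
      exact ⟨f, rfl⟩⟩

end Minimal

theorem finrank_ext (n : ℕ) : Module.finrank k (CategoryTheory.Abelian.Ext
      (trivialModule (augA k)) (trivialModule (augA k)) n) = n + 1 := by
  rw [← (homEquivExt (totResolution k) k (totComplex_d_comp k) n).finrank_eq]
  exact (homTrivialModuleEquiv k n).finrank_eq.trans (by simp)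

end Ext

/-! ### The bar differential on the dual basis -/

section Letters

variable (k : Type u) [Field k]

theorem coord_mul (x y : A k) : coord k (x * y) =
    ![coord k x 0 * coord k y 0,
      coord k x 0 * coord k y 1 + coord k x 1 * coord k y 0,
      coord k x 0 * coord k y 2 + coord k x 2 * coord k y 0,
      coord k x 0 * coord k y 3 + coord k x 1 * coord k y 2 + coord k x 3 * coord k y 0,
      coord k x 0 * coord k y 4 + coord k x 2 * coord k y 1 + coord k x 4 * coord k y 0,
      coord k x 0 * coord k y 5 + coord k x 1 * coord k y 4 + coord k x 2 * coord k y 3 +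
        coord k x 3 * coord k y 1 + coord k x 4 * coord k y 2 + coord k x 5 * coord k y 0] := by
  conv_lhs => rw [← sum_coord_smul k y]
  rw [Finset.mul_sum]
  simp only [mul_smul_comm, Fin.sum_univ_succ, monA]
  ext j
  fin_cases j <;> simp [← mul_assoc, coord_mul_genA, coord_mul_genB] <;> ring

/-- The coordinates other than the constant one, as linear functionals on `A₊`. -/
def dualGen (i : Fin 5) : Module.Dual k (Aug (augA k)) :=
  LinearMap.proj i.succ ∘ₗ coord k ∘ₗ (Aug (augA k)).subtype

theorem dualGen_apply (i : Fin 5) (x : Aug (augA k)) : dualGen k i x = coord k x.1 i.succ := rfl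

/-- The monomials `a, b, ab, ba, aba` as elements of `A₊`. -/
def augMon (i : Fin 5) : Aug (augA k) :=
  ⟨monA k i.succ, by
    change augA k (monA k i.succ) = 0
    rw [augA_eq, coord_monA]
    simp⟩

theorem dualGen_augMon (i j : Fin 5) : dualGen k i (augMon k j) = if i = j then 1 else 0 := by
  simp [dualGen_apply, augMon, coord_monA, Pi.single_apply]

theorem sum_smul_dualGen (f : Module.Dual k (Aug (augA k))) :
    ∑ i, f (augMon k i) • dualGen k i = f := by
  refine LinearMap.ext fun x => ?_
  have hx : x = ∑ i, dualGen k i x • augMon k i := by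
    apply Subtype.ext
    conv_lhs => rw [← sum_coord_smul k x.1]
    have h0 : coord k x.1 0 = 0 := by rw [← augA_eq]; exact x.2
    simp [Fin.sum_univ_succ (n := 5), h0, dualGen_apply, augMon]
  conv_rhs => rw [hx, map_sum]
  simp [mul_comm]

/-- The generators of `T(V)`: the basis of `V` dual to `a, b, ab, ba, aba`. -/
def letter (i : Fin 5) : Bar (augA k) := TensorAlgebra.ι k (dualGen k i)

theorem delta_letter_of {f : Module.Dual k (Aug (augA k))} {m : ℕ} (u v : Fin m → Fin 5)
    (h : ∀ x y : Aug (augA k), f (augMul (augA k) (x ⊗ₜ y)) =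
      ∑ i, dualGen k (u i) x * dualGen k (v i) y) :
    delta (augA k) (TensorAlgebra.ι k f) = -∑ i, letter k (u i) * letter k (v i) := by
  rw [delta_ι, delta₁_eq (augA k) f (∑ i, dualGen k (u i) ⊗ₜ dualGen k (v i))]
  · simp [letter]
  · refine TensorProduct.ext' fun x y => ?_
    rw [map_sum, LinearMap.sum_apply, LinearMap.comp_apply, h]
    rfl

theorem coord_augMul (x y : Aug (augA k)) : coord k (augMul (augA k) (x ⊗ₜ y)).1 =
    ![0, 0, 0, coord k x.1 1 * coord k y.1 2, coord k x.1 2 * coord k y.1 1,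
      coord k x.1 1 * coord k y.1 4 + coord k x.1 2 * coord k y.1 3 +
        coord k x.1 3 * coord k y.1 1 + coord k x.1 4 * coord k y.1 2] := by
  have hx : coord k x.1 0 = 0 := by rw [← augA_eq]; exact x.2
  have hy : coord k y.1 0 = 0 := by rw [← augA_eq]; exact y.2
  change coord k (x.1 * y.1) = _
  rw [coord_mul, hx, hy]
  simp

@[simp]
theorem delta_letter_zero : delta (augA k) (letter k 0) = 0 := by
  refine (delta_letter_of k (f := dualGen k 0) (m := 0) ![] ![] fun x y => ?_).trans ?_
  · rw [dualGen_apply, coord_augMul]; simp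
  · simp

@[simp]
theorem delta_letter_one : delta (augA k) (letter k 1) = 0 := by
  refine (delta_letter_of k (f := dualGen k 1) (m := 0) ![] ![] fun x y => ?_).trans ?_
  · rw [dualGen_apply, coord_augMul]; simp
  · simp

@[simp]
theorem delta_letter_two : delta (augA k) (letter k 2) = -(letter k 0 * letter k 1) := by
  refine (delta_letter_of k (f := dualGen k 2) ![0] ![1] fun x y => ?_).trans ?_
  · rw [dualGen_apply, coord_augMul]; simp [dualGen_apply]
  · simp

@[simp]
theorem delta_letter_three : delta (augA k) (letter k 3) = -(letter k 1 * letter k 0) := by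
  refine (delta_letter_of k (f := dualGen k 3) ![1] ![0] fun x y => ?_).trans ?_
  · rw [dualGen_apply, coord_augMul]; simp [dualGen_apply]
  · simp

-- The four terms are the factorizations $a\cdot ba$, $b\cdot ab$, $ab\cdot a$, $ba\cdot b$ of
-- $aba$.
@[simp]
theorem delta_letter_four : delta (augA k) (letter k 4) =
    -(letter k 0 * letter k 3 + letter k 1 * letter k 2 + letter k 2 * letter k 0 +
      letter k 3 * letter k 1) := by
  refine (delta_letter_of k (f := dualGen k 4) ![0, 1, 2, 3] ![3, 2, 0, 1] fun x y => ?_).trans ?_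
  · rw [dualGen_apply, coord_augMul]; simp [dualGen_apply, Fin.sum_univ_four]
  · simp [Fin.sum_univ_four, add_assoc]

theorem delta_mul_letter (i : Fin 5) (t : Bar (augA k)) :
    delta (augA k) (t * letter k i) =
      delta (augA k) t * letter k i + barSign (augA k) t * delta (augA k) (letter k i) :=
  delta_mul _ _ _

end Letters

/-! ### Decomposition of cochains by their last letter -/

section Coefficients

variable (k : Type u) [Field k]

/-- The algebra map `t ↦ !![t, tᵢ; 0, ε t]`, where `tᵢ` is the right coefficient of the `i`-th
generator. -/
def coefMatrix (i : Fin 5) : Bar (augA k) →ₐ[k] Matrix (Fin 2) (Fin 2) (Bar (augA k)) :=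
  TensorAlgebra.lift k
    { toFun := fun f => !![TensorAlgebra.ι k f, algebraMap k _ (f (augMon k i)); 0, 0]
      map_add' := fun f g => by
        ext i j; fin_cases i <;> fin_cases j <;> simp
      map_smul' := fun c f => by
        ext i j; fin_cases i <;> fin_cases j <;> simp [Algebra.smul_def] }

/-- The right coefficient of the `i`-th generator: `t = ε t + ∑ i, coef i t * letter i`. -/
def coef (i : Fin 5) : Bar (augA k) →ₗ[k] Bar (augA k) :=
  Matrix.entryLinearMap k (Bar (augA k)) (0 : Fin 2) (1 : Fin 2) ∘ₗ (coefMatrix k i).toLinearMap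

theorem coefMatrix_zero_zero (i : Fin 5) (t : Bar (augA k)) :
    coefMatrix k i t 0 0 = t ∧ coefMatrix k i t 1 0 = 0 := by
  induction t using TensorAlgebra.induction with
  | algebraMap r => simp [Matrix.algebraMap_matrix_apply]
  | ι x => simp [coefMatrix]
  | mul a b ha hb => simp [Matrix.mul_apply, Fin.sum_univ_two, ha.1, ha.2, hb.1, hb.2]
  | add a b ha hb => simp [ha.1, ha.2, hb.1, hb.2]

theorem coef_algebraMap (i : Fin 5) (r : k) : coef k i (algebraMap k _ r) = 0 := by
  simp [coef, Matrix.algebraMap_matrix_apply]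

theorem coef_mul_ι (i : Fin 5) (t : Bar (augA k)) (f : Module.Dual k (Aug (augA k))) :
    coef k i (t * TensorAlgebra.ι k f) = f (augMon k i) • t := by
  have h : coef k i (t * TensorAlgebra.ι k f) =
      t * coefMatrix k i (TensorAlgebra.ι k f) 0 1 +
        coefMatrix k i t 0 1 * coefMatrix k i (TensorAlgebra.ι k f) 1 1 := by
    simp [coef, Matrix.mul_apply, Fin.sum_univ_two, coefMatrix_zero_zero]
  rw [h]
  simp [coefMatrix, Algebra.smul_def, Algebra.commutes]

theorem coef_mul_letter (i j : Fin 5) (t : Bar (augA k)) :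
    coef k i (t * letter k j) = if j = i then t else 0 := by
  rw [letter, coef_mul_ι, dualGen_augMon]
  split_ifs <;> simp

/-- This is $T(V)=k\oplus T(V)\otimes V$. In the product case the matrix encoding amounts to the
twisted Leibniz rule $(st)_i=s\,t_i+s_i\,\varepsilon(t)$. -/
theorem eq_sum_coef_mul_letter (t : Bar (augA k)) :
    t = algebraMap k _ (TensorAlgebra.algebraMapInv t) + ∑ i, coef k i t * letter k i := by
  induction t using TensorAlgebra.induction with
  | algebraMap r => simp [coef_algebraMap]
  | ι f =>
    have h : ∀ i, coef k i (TensorAlgebra.ι k f) = algebraMap k _ (f (augMon k i)) := fun i => by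
      rw [← one_mul (TensorAlgebra.ι k f), coef_mul_ι, Algebra.algebraMap_eq_smul_one]
    simp only [h, letter, ← Algebra.smul_def, ← map_smul, ← map_sum, sum_smul_dualGen]
    simp [TensorAlgebra.algebraMapInv]
  | mul a b ha hb =>
    have h : ∀ i, coef k i (a * b) =
        a * coef k i b + coef k i a * algebraMap k _ (TensorAlgebra.algebraMapInv b) := by
      intro i
      conv_lhs => rw [hb, mul_add, Finset.mul_sum, map_add, map_sum]
      simp only [← mul_assoc, coef_mul_letter]
      rw [← Algebra.commutes, ← Algebra.smul_def, map_smul, Algebra.smul_def, Algebra.commutes]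
      simp [add_comm]
    simp only [h, add_mul, Finset.sum_add_distrib, mul_assoc, ← Finset.mul_sum]
    have h' : ∀ i, coef k i a * (algebraMap k _ (TensorAlgebra.algebraMapInv b) * letter k i) =
        coef k i a * letter k i * algebraMap k _ (TensorAlgebra.algebraMapInv b) := fun i => by
      rw [Algebra.commutes, mul_assoc]
    simp only [h', ← Finset.sum_mul, map_mul]
    conv_lhs => rw [hb, mul_add]
    conv_lhs => enter [1]; rw [ha]
    noncomm_ring
  | add a b ha hb =>
    conv_lhs => rw [ha, hb]
    simp only [map_add, add_mul, Finset.sum_add_distrib]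
    abel

/-- Apply the graded Leibniz rule to $\sum t_jl_j$. A word ending in $l_i$ occurs in $\delta l_j$
only for $j>i$, so the resulting equations are triangular and can be solved from $l_4$ downwards. -/
theorem coef_delta (i : Fin 5) (t : Bar (augA k)) :
    coef k i (delta (augA k) t) = delta (augA k) (coef k i t) +
      ∑ j, coef k i (barSign (augA k) (coef k j t) * delta (augA k) (letter k j)) := by
  conv_lhs => rw [eq_sum_coef_mul_letter k t]
  rw [map_add, delta_algebraMap, zero_add, map_sum, map_sum]
  simp only [delta_mul_letter, map_add, Finset.sum_add_distrib, coef_mul_letter]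
  simp

theorem coef_zero_delta (t : Bar (augA k)) : coef k 0 (delta (augA k) t) =
    delta (augA k) (coef k 0 t) - barSign (augA k) (coef k 3 t) * letter k 1 -
      barSign (augA k) (coef k 4 t) * letter k 2 := by
  rw [coef_delta]
  simp [Fin.sum_univ_five, mul_add, ← mul_assoc, coef_mul_letter]
  abel

theorem coef_one_delta (t : Bar (augA k)) : coef k 1 (delta (augA k) t) =
    delta (augA k) (coef k 1 t) - barSign (augA k) (coef k 2 t) * letter k 0 -
      barSign (augA k) (coef k 4 t) * letter k 3 := by
  rw [coef_delta]
  simp [Fin.sum_univ_five, mul_add, ← mul_assoc, coef_mul_letter]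
  abel

theorem coef_two_delta (t : Bar (augA k)) : coef k 2 (delta (augA k) t) =
    delta (augA k) (coef k 2 t) - barSign (augA k) (coef k 4 t) * letter k 1 := by
  rw [coef_delta]
  simp [Fin.sum_univ_five, mul_add, ← mul_assoc, coef_mul_letter]
  abel

theorem coef_three_delta (t : Bar (augA k)) : coef k 3 (delta (augA k) t) =
    delta (augA k) (coef k 3 t) - barSign (augA k) (coef k 4 t) * letter k 0 := by
  rw [coef_delta]
  simp [Fin.sum_univ_five, mul_add, ← mul_assoc, coef_mul_letter]
  abel

theorem coef_four_delta (t : Bar (augA k)) : coef k 4 (delta (augA k) t) =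
    delta (augA k) (coef k 4 t) := by
  rw [coef_delta]
  simp [Fin.sum_univ_five, mul_add, ← mul_assoc, coef_mul_letter]

/-- By the Leibniz rule it suffices to check the letters, where the identity expresses associativity
of $A$. -/
theorem delta_delta (t : Bar (augA k)) : delta (augA k) (delta (augA k) t) = 0 := by
  induction t using TensorAlgebra.induction with
  | algebraMap r => simp [delta_algebraMap]
  | ι f =>
    rw [← sum_smul_dualGen k f]
    have h : ∀ i, delta (augA k) (delta (augA k) (TensorAlgebra.ι k (dualGen k i))) = 0 := by
      intro i
      change delta (augA k) (delta (augA k) (letter k i)) = 0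
      have hs : ∀ j, barSign (augA k) (letter k j) = -letter k j := fun j => by
        simp [barSign, letter]
      fin_cases i <;> simp [delta_mul, hs, mul_assoc]
    simp [h]
  | mul a b ha hb =>
    rw [delta_mul, map_add, delta_mul, delta_mul, ha, hb, delta_barSign]
    simp
  | add a b ha hb => simp [ha, hb]

end Coefficients

/-! ### The grading of $T(V)$ -/

section Homogeneous

variable (k : Type u) [Field k]

/-- The homogeneous component `V^{⊗ n}` of `T(V)`. -/
abbrev homog (n : ℕ) : Submodule k (Bar (augA k)) :=
  LinearMap.range (TensorAlgebra.ι k : Module.Dual k (Aug (augA k)) →ₗ[k] Bar (augA k)) ^ n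

variable {k}

theorem letter_mem (i : Fin 5) : letter k i ∈ homog k 1 := by
  rw [homog, pow_one]
  exact ⟨_, rfl⟩

theorem mul_mem_homog {m n : ℕ} {s t : Bar (augA k)} (hs : s ∈ homog k m) (ht : t ∈ homog k n) :
    s * t ∈ homog k (m + n) := by
  rw [homog, pow_add]
  exact Submodule.mul_mem_mul hs ht

theorem barSign_of_mem {n : ℕ} {t : Bar (augA k)} (ht : t ∈ homog k n) :
    barSign (augA k) t = (-1 : k) ^ n • t := by
  induction ht using Submodule.pow_induction_on_left' with
  | algebraMap r => simp
  | add x y i hx hy ihx ihy => rw [map_add, ihx, ihy, smul_add]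
  | mem_mul m hm i x hx ih =>
    obtain ⟨f, rfl⟩ := hm
    rw [map_mul, ih, pow_succ]
    simp [barSign]

theorem delta_mem {n : ℕ} {t : Bar (augA k)} (ht : t ∈ homog k n) :
    delta (augA k) t ∈ homog k (n + 1) := by
  have hl : ∀ i, delta (augA k) (letter k i) ∈ homog k 2 := by
    have h : ∀ i j, letter k i * letter k j ∈ homog k 2 :=
      fun i j => mul_mem_homog (letter_mem i) (letter_mem j)
    intro i
    fin_cases i
    · simp
    · simp
    · simpa using h 0 1
    · simpa using h 1 0
    · simp only [Fin.reduceFinMk, delta_letter_four]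
      exact neg_mem (add_mem (add_mem (add_mem (h _ _) (h _ _)) (h _ _)) (h _ _))
  have hι : ∀ f, delta (augA k) (TensorAlgebra.ι k f) ∈ homog k 2 := by
    intro f
    rw [← sum_smul_dualGen k f, map_sum, map_sum]
    refine Submodule.sum_mem _ fun i _ => ?_
    rw [map_smul, map_smul]
    exact Submodule.smul_mem _ _ (hl i)
  induction ht using Submodule.pow_induction_on_left' with
  | algebraMap r => rw [delta_algebraMap]; exact Submodule.zero_mem _
  | add x y i hx hy ihx ihy => rw [map_add]; exact add_mem ihx ihy
  | mem_mul m hm i x hx ih =>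
    obtain ⟨f, rfl⟩ := hm
    rw [delta_ι_mul, ← delta_ι, show i.succ + 1 = 2 + i by omega]
    refine sub_mem (mul_mem_homog (hι f) hx) ?_
    rw [show 2 + i = 1 + (i + 1) by omega]
    exact mul_mem_homog (by rw [homog, pow_one]; exact ⟨f, rfl⟩) ih

theorem coef_mem (i : Fin 5) {n : ℕ} {t : Bar (augA k)} (ht : t ∈ homog k (n + 1)) :
    coef k i t ∈ homog k n := by
  rw [homog, pow_succ] at ht
  induction ht using Submodule.mul_induction_on' with
  | mem_mul_mem s hs f hf =>
    obtain ⟨f, rfl⟩ := hf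
    rw [coef_mul_ι]
    exact Submodule.smul_mem _ _ hs
  | add x _ y _ hx hy => rw [map_add]; exact add_mem hx hy

theorem algebraMapInv_of_mem {n : ℕ} {t : Bar (augA k)} (ht : t ∈ homog k (n + 1)) :
    TensorAlgebra.algebraMapInv t = 0 := by
  rw [homog, pow_succ] at ht
  induction ht using Submodule.mul_induction_on' with
  | mem_mul_mem s hs f hf =>
    obtain ⟨f, rfl⟩ := hf
    simp [TensorAlgebra.algebraMapInv]
  | add x _ y _ hx hy => rw [map_add, hx, hy, add_zero]

theorem sum_coef_mul_letter {n : ℕ} {t : Bar (augA k)} (ht : t ∈ homog k (n + 1)) :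
    ∑ i, coef k i t * letter k i = t := by
  conv_rhs => rw [eq_sum_coef_mul_letter k t, algebraMapInv_of_mem ht, map_zero, zero_add]

end Homogeneous

/-! ### Normal monomials in algebras satisfying the relations -/

section Monomials

variable {k : Type u} [Field k] {R : Type v} [Ring R] [Algebra k R]

/-- The monomial `z^q x^(p-q)` if `q ≤ p`, and `z^p y^(q-p)` if `p ≤ q`. -/
def mon (x y z : R) (p q : ℕ) : R := z ^ min p q * x ^ (p - q) * y ^ (q - p)

theorem mon_zero_zero (x y z : R) : mon x y z 0 0 = 1 := by simp [mon]

theorem mon_succ_left (x y z : R) {p q : ℕ} (h : q ≤ p) :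
    mon x y z (p + 1) q = mon x y z p q * x := by
  rw [mon, mon, min_eq_right h, min_eq_right (h.trans p.le_succ), Nat.succ_sub h,
    Nat.sub_eq_zero_of_le h, Nat.sub_eq_zero_of_le (h.trans p.le_succ), pow_succ]
  simp [mul_assoc]

theorem mon_succ_right (x y z : R) {p q : ℕ} (h : p ≤ q) :
    mon x y z p (q + 1) = mon x y z p q * y := by
  rw [mon, mon, min_eq_left h, min_eq_left (h.trans q.le_succ), Nat.succ_sub h,
    Nat.sub_eq_zero_of_le h, Nat.sub_eq_zero_of_le (h.trans q.le_succ), pow_succ]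
  simp [mul_assoc]

theorem mon_succ_succ_self (x y z : R) (p : ℕ) :
    mon x y z (p + 1) (p + 1) = mon x y z p p * z := by
  simp [mon, pow_succ]

theorem mon_add_left (x y z : R) (q d : ℕ) : mon x y z (q + d) q = z ^ q * x ^ d := by
  simp [mon]

theorem mon_add_right (x y z : R) (p d : ℕ) : mon x y z p (p + d) = z ^ p * y ^ d := by
  simp [mon]

theorem map_mon {S : Type*} [Ring S] [Algebra k S] (f : R →ₐ[k] S) (x y z : R) (p q : ℕ) :
    f (mon x y z p q) = mon (f x) (f y) (f z) p q := by
  simp [mon]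

/-- The combination of the monomials of degree `n` with coefficients `c`. -/
def monSum (x y z : R) (n : ℕ) : (ℕ → ℕ → k) →ₗ[k] R where
  toFun c := ∑ i ∈ Finset.HasAntidiagonal.antidiagonal n, c i.1 i.2 • mon x y z i.1 i.2
  map_add' c d := by simp [add_smul, Finset.sum_add_distrib]
  map_smul' r c := by simp [mul_smul, Finset.smul_sum]

theorem monSum_apply (x y z : R) (n : ℕ) (c : ℕ → ℕ → k) :
    monSum x y z n c =
      ∑ i ∈ Finset.HasAntidiagonal.antidiagonal n, c i.1 i.2 • mon x y z i.1 i.2 := rfl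

theorem monSum_congr (x y z : R) {n : ℕ} {c d : ℕ → ℕ → k}
    (h : ∀ p q, p + q = n → c p q = d p q) : monSum x y z n c = monSum x y z n d := by
  rw [monSum_apply, monSum_apply]
  exact Finset.sum_congr rfl fun i hi => by
    rw [h i.1 i.2 (Finset.HasAntidiagonal.mem_antidiagonal.mp hi)]

theorem monSum_eq_zero (x y z : R) {n : ℕ} {c : ℕ → ℕ → k}
    (h : ∀ p q, p + q = n → c p q = 0) : monSum x y z n c = 0 :=
  (monSum_congr x y z (d := 0) h).trans (map_zero _)

theorem monSum_zero (x y z : R) (c : ℕ → ℕ → k) : monSum x y z 0 c = c 0 0 • 1 := by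
  simp [monSum_apply, mon_zero_zero]

theorem monSum_one (x y z : R) (c : ℕ → ℕ → k) :
    monSum x y z 1 c = c 1 0 • x + c 0 1 • y := by
  simp [monSum_apply, Finset.Nat.antidiagonal_succ, mon, add_comm]

/-- Sort by last letter: a monomial of positive degree ends in $x$, $y$ or $z$ according to $p>q$,
$p<q$ or $p=q$. -/
theorem monSum_add_two (x y z : R) (n : ℕ) (c : ℕ → ℕ → k) : monSum x y z (n + 2) c =
    monSum x y z (n + 1) (fun p q => if q ≤ p then c (p + 1) q else 0) * x +
    monSum x y z (n + 1) (fun p q => if p ≤ q then c p (q + 1) else 0) * y +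
    monSum x y z n (fun p q => if p = q then c (p + 1) (q + 1) else 0) * z := by
  have h₁ : monSum x y z (n + 1) (fun p q => if q ≤ p then c (p + 1) q else 0) * x =
      ∑ i ∈ Finset.HasAntidiagonal.antidiagonal (n + 2),
        if i.2 < i.1 then c i.1 i.2 • mon x y z i.1 i.2 else 0 := by
    rw [Finset.Nat.sum_antidiagonal_succ, monSum_apply, Finset.sum_mul]
    simp only [Nat.not_lt_zero, if_false, zero_add]
    refine Finset.sum_congr rfl fun i _ => ?_
    by_cases h : i.2 ≤ i.1
    · rw [if_pos h, if_pos (by omega), mon_succ_left x y z h, smul_mul_assoc]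
    · rw [if_neg h, if_neg (by omega), zero_smul, zero_mul]
  have h₂ : monSum x y z (n + 1) (fun p q => if p ≤ q then c p (q + 1) else 0) * y =
      ∑ i ∈ Finset.HasAntidiagonal.antidiagonal (n + 2),
        if i.1 < i.2 then c i.1 i.2 • mon x y z i.1 i.2 else 0 := by
    rw [Finset.Nat.sum_antidiagonal_succ', monSum_apply, Finset.sum_mul]
    simp only [Nat.not_lt_zero, if_false, zero_add]
    refine Finset.sum_congr rfl fun i _ => ?_
    by_cases h : i.1 ≤ i.2
    · rw [if_pos h, if_pos (by omega), mon_succ_right x y z h, smul_mul_assoc]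
    · rw [if_neg h, if_neg (by omega), zero_smul, zero_mul]
  have h₃ : monSum x y z n (fun p q => if p = q then c (p + 1) (q + 1) else 0) * z =
      ∑ i ∈ Finset.HasAntidiagonal.antidiagonal (n + 2),
        if i.1 = i.2 then c i.1 i.2 • mon x y z i.1 i.2 else 0 := by
    rw [Finset.Nat.sum_antidiagonal_succ, Finset.Nat.sum_antidiagonal_succ', monSum_apply,
      Finset.sum_mul]
    rw [if_neg (by simp), if_neg (by simp), zero_add, zero_add]
    refine Finset.sum_congr rfl fun i _ => ?_
    by_cases h : i.1 = i.2
    · rw [if_pos h, if_pos (by omega), smul_mul_assoc, h, mon_succ_succ_self]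
    · rw [if_neg h, if_neg (by omega), zero_smul, zero_mul]
  rw [h₁, h₂, h₃, monSum_apply, ← Finset.sum_add_distrib, ← Finset.sum_add_distrib]
  refine Finset.sum_congr rfl fun i _ => ?_
  rcases lt_trichotomy i.1 i.2 with h | h | h
  · simp [h, h.ne, h.not_gt]
  · simp [h]
  · simp [h, h.ne', h.not_gt]

variable (k) in
/-- The span of the monomials of degree `n`. -/
def monSpan (x y z : R) (n : ℕ) : Submodule k R := LinearMap.range (monSum (k := k) x y z n)

theorem mon_mem_monSpan (x y z : R) (p q : ℕ) : mon x y z p q ∈ monSpan k x y z (p + q) := by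
  refine ⟨fun i j => if i = p ∧ j = q then 1 else 0, ?_⟩
  rw [monSum_apply, Finset.sum_eq_single (p, q)]
  · simp
  · rintro ⟨i, j⟩ _ h
    rw [if_neg fun h' => h (Prod.ext h'.1 h'.2), zero_smul]
  · simp

theorem map_monSum {S : Type*} [Ring S] [Algebra k S] (f : R →ₐ[k] S) (x y z : R) (n : ℕ)
    (c : ℕ → ℕ → k) : f (monSum x y z n c) = monSum (f x) (f y) (f z) n c := by
  simp [monSum_apply, map_mon]

theorem map_monSpan {S : Type*} [Ring S] [Algebra k S] (f : R →ₐ[k] S) (x y z : R) (n : ℕ) :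
    (monSpan k x y z n).map f.toLinearMap = monSpan k (f x) (f y) (f z) n := by
  ext e
  constructor
  · rintro ⟨_, ⟨c, rfl⟩, rfl⟩
    exact ⟨c, (map_monSum f x y z n c).symm⟩
  · rintro ⟨c, rfl⟩
    exact ⟨_, ⟨c, rfl⟩, map_monSum f x y z n c⟩

/-- The defining relations of `k⟨x, y, z | xy, yx, zx + yz, xz + zy⟩`. -/
structure IsERel (x y z : R) : Prop where
  xy : x * y = 0
  yx : y * x = 0
  zx : z * x = -(y * z)
  xz : x * z = -(z * y)

namespace IsERel

variable {x y z : R} (h : IsERel x y z)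

include h

theorem mon_mul_x (p q : ℕ) :
    mon x y z p q * x = if q ≤ p then mon x y z (p + 1) q else 0 := by
  split_ifs with hpq
  · rw [mon_succ_left _ _ _ hpq]
  · obtain ⟨d, rfl⟩ : ∃ d, q = p + (d + 1) := ⟨q - p - 1, by omega⟩
    rw [mon_add_right, pow_succ, mul_assoc, mul_assoc, h.yx, mul_zero, mul_zero]

theorem mon_mul_y (p q : ℕ) :
    mon x y z p q * y = if p ≤ q then mon x y z p (q + 1) else 0 := by
  split_ifs with hpq
  · rw [mon_succ_right _ _ _ hpq]
  · obtain ⟨d, rfl⟩ : ∃ d, p = q + (d + 1) := ⟨p - q - 1, by omega⟩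
    rw [mon_add_left, pow_succ, mul_assoc, mul_assoc, h.xy, mul_zero, mul_zero]

theorem x_pow_mul_z (n : ℕ) : x ^ n * z = (-1 : k) ^ n • (z * y ^ n) := by
  induction n with
  | zero => simp
  | succ n ih =>
    rw [pow_succ, mul_assoc, h.xz, mul_neg, ← mul_assoc, ih, smul_mul_assoc, mul_assoc,
      ← pow_succ, pow_succ (-1 : k)]
    simp

theorem y_pow_mul_z (n : ℕ) : y ^ n * z = (-1 : k) ^ n • (z * x ^ n) := by
  have hyz : y * z = -(z * x) := by rw [h.zx, neg_neg]
  induction n with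
  | zero => simp
  | succ n ih =>
    rw [pow_succ, mul_assoc, hyz, mul_neg, ← mul_assoc, ih, smul_mul_assoc, mul_assoc,
      ← pow_succ, pow_succ (-1 : k)]
    simp

/-- Moving $z$ to the left past a power of $x$ or $y$ exchanges the two letters, hence the exchange
of $p$ and $q$; the scalar is a sign. -/
theorem mon_mul_z (p q : ℕ) : ∃ r : k, mon x y z p q * z = r • mon x y z (q + 1) (p + 1) := by
  rcases le_total q p with hpq | hpq
  · obtain ⟨d, rfl⟩ := Nat.exists_eq_add_of_le hpq
    refine ⟨(-1) ^ d, ?_⟩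
    rw [mon_add_left, mul_assoc, h.x_pow_mul_z (k := k), add_right_comm, mon_add_right,
      mul_smul_comm, pow_succ, mul_assoc]
  · obtain ⟨d, rfl⟩ := Nat.exists_eq_add_of_le hpq
    refine ⟨(-1) ^ d, ?_⟩
    rw [mon_add_right, mul_assoc, h.y_pow_mul_z (k := k), add_right_comm, mon_add_left,
      mul_smul_comm, pow_succ, mul_assoc]

theorem monSum_mul_x (n : ℕ) (c : ℕ → ℕ → k) : monSum x y z n c * x =
    monSum x y z (n + 1) (fun p q => if q < p then c (p - 1) q else 0) := by
  rw [monSum_apply, monSum_apply, Finset.Nat.sum_antidiagonal_succ, Finset.sum_mul]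
  simp only [Nat.not_lt_zero, if_false, zero_smul, zero_add, Nat.add_sub_cancel]
  refine Finset.sum_congr rfl fun i _ => ?_
  rw [smul_mul_assoc, h.mon_mul_x]
  by_cases hi : i.2 ≤ i.1
  · rw [if_pos hi, if_pos (by omega)]
  · rw [if_neg hi, if_neg (by omega), smul_zero, zero_smul]

theorem monSum_mul_y (n : ℕ) (c : ℕ → ℕ → k) : monSum x y z n c * y =
    monSum x y z (n + 1) (fun p q => if p < q then c p (q - 1) else 0) := by
  rw [monSum_apply, monSum_apply, Finset.Nat.sum_antidiagonal_succ', Finset.sum_mul]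
  simp only [Nat.not_lt_zero, if_false, zero_smul, zero_add, Nat.add_sub_cancel]
  refine Finset.sum_congr rfl fun i _ => ?_
  rw [smul_mul_assoc, h.mon_mul_y]
  by_cases hi : i.1 ≤ i.2
  · rw [if_pos hi, if_pos (by omega)]
  · rw [if_neg hi, if_neg (by omega), smul_zero, zero_smul]

theorem mul_x_mem {n : ℕ} {e : R} (he : e ∈ monSpan k x y z n) :
    e * x ∈ monSpan k x y z (n + 1) := by
  obtain ⟨c, rfl⟩ := he
  exact ⟨_, (h.monSum_mul_x n c).symm⟩

theorem mul_y_mem {n : ℕ} {e : R} (he : e ∈ monSpan k x y z n) :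
    e * y ∈ monSpan k x y z (n + 1) := by
  obtain ⟨c, rfl⟩ := he
  exact ⟨_, (h.monSum_mul_y n c).symm⟩

theorem mul_z_mem {n : ℕ} {e : R} (he : e ∈ monSpan k x y z n) :
    e * z ∈ monSpan k x y z (n + 2) := by
  obtain ⟨c, rfl⟩ := he
  rw [monSum_apply, Finset.sum_mul]
  refine Submodule.sum_mem _ fun i hi => ?_
  obtain ⟨r, hr⟩ := h.mon_mul_z (k := k) i.1 i.2
  rw [smul_mul_assoc, hr]
  have hn : n + 2 = i.2 + 1 + (i.1 + 1) := by
    have := Finset.HasAntidiagonal.mem_antidiagonal.mp hi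
    omega
  rw [hn]
  exact Submodule.smul_mem _ _ (Submodule.smul_mem _ _ (mon_mem_monSpan _ _ _ _ _))

end IsERel

end Monomials

/-! ### Cocycle representatives and the relations in $E(A)$ -/

section Representatives

variable {k : Type u} [Field k]

/-- The cocycle `t` represents the class `e`. -/
def Rep (t : Bar (augA k)) (e : YonedaRing (augA k)) : Prop :=
  ∃ c : cocycles (augA k), c.1 = t ∧ Ideal.Quotient.mkₐ k (coboundaries (augA k)) c = e

theorem exists_rep {t : Bar (augA k)} (h : delta (augA k) t = 0) : ∃ e, Rep t e :=
  ⟨_, ⟨t, h⟩, rfl, rfl⟩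

namespace Rep

variable {s t : Bar (augA k)} {d e : YonedaRing (augA k)}

theorem delta_eq_zero (h : Rep t e) : delta (augA k) t = 0 := by
  obtain ⟨c, rfl, _⟩ := h
  exact c.2

theorem add (hs : Rep s d) (ht : Rep t e) : Rep (s + t) (d + e) := by
  obtain ⟨a, rfl, rfl⟩ := hs
  obtain ⟨b, rfl, rfl⟩ := ht
  exact ⟨a + b, rfl, map_add _ _ _⟩

theorem mul (hs : Rep s d) (ht : Rep t e) : Rep (s * t) (d * e) := by
  obtain ⟨a, rfl, rfl⟩ := hs
  obtain ⟨b, rfl, rfl⟩ := ht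
  exact ⟨a * b, rfl, map_mul _ _ _⟩

theorem smul (r : k) (ht : Rep t e) : Rep (r • t) (r • e) := by
  obtain ⟨b, rfl, rfl⟩ := ht
  exact ⟨r • b, rfl, map_smul (Ideal.Quotient.mkₐ k (coboundaries (augA k))) _ _⟩

theorem neg (ht : Rep t e) : Rep (-t) (-e) := by
  obtain ⟨b, rfl, rfl⟩ := ht
  exact ⟨-b, rfl, map_neg _ _⟩

theorem sub (hs : Rep s d) (ht : Rep t e) : Rep (s - t) (d - e) := by
  rw [sub_eq_add_neg, sub_eq_add_neg]
  exact hs.add ht.neg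

theorem zero : Rep (0 : Bar (augA k)) 0 := ⟨0, rfl, map_zero _⟩

theorem one : Rep (1 : Bar (augA k)) 1 := ⟨1, rfl, map_one _⟩

theorem pow (ht : Rep t e) (n : ℕ) : Rep (t ^ n) (e ^ n) := by
  induction n with
  | zero => simpa using one
  | succ n ih => rw [pow_succ, pow_succ]; exact ih.mul ht

theorem sum {ι : Type*} (S : Finset ι) {f : ι → Bar (augA k)} {g : ι → YonedaRing (augA k)}
    (h : ∀ i ∈ S, Rep (f i) (g i)) : Rep (∑ i ∈ S, f i) (∑ i ∈ S, g i) := by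
  classical
  induction S using Finset.induction_on with
  | empty => simpa using zero
  | insert i S hi ih =>
    rw [Finset.sum_insert hi, Finset.sum_insert hi]
    exact (h i (Finset.mem_insert_self i S)).add
      (ih fun j hj => h j (Finset.mem_insert_of_mem hj))

theorem eq_zero_iff (h : Rep t e) : e = 0 ↔ ∃ w, delta (augA k) w = t := by
  obtain ⟨c, rfl, rfl⟩ := h
  exact Ideal.Quotient.eq_zero_iff_mem

theorem unique (h : Rep t d) (h' : Rep t e) : d = e := by
  obtain ⟨a, rfl, rfl⟩ := h
  obtain ⟨b, hb, rfl⟩ := h'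
  rw [Subtype.ext hb]

theorem delta (w : Bar (augA k)) : Rep (delta (augA k) w) 0 := by
  obtain ⟨e, he⟩ := exists_rep (delta_delta k w)
  rwa [← he.eq_zero_iff.mpr ⟨w, rfl⟩]

theorem eq_of_sub_eq_delta (hs : Rep s d) (ht : Rep t e) (w : Bar (augA k))
    (h : s - t = YonedaFK.delta (augA k) w) : d = e :=
  sub_eq_zero.mp ((hs.sub ht).eq_zero_iff.mpr ⟨w, h.symm⟩)

theorem mon {x y z : Bar (augA k)} {x' y' z' : YonedaRing (augA k)} (hx : Rep x x')
    (hy : Rep y y') (hz : Rep z z') (p q : ℕ) : Rep (mon x y z p q) (mon x' y' z' p q) :=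
  ((hz.pow _).mul (hx.pow _)).mul (hy.pow _)

theorem monSum {x y z : Bar (augA k)} {x' y' z' : YonedaRing (augA k)} (hx : Rep x x')
    (hy : Rep y y') (hz : Rep z z') (n : ℕ) (c : ℕ → ℕ → k) :
    Rep (monSum x y z n c) (monSum x' y' z' n c) :=
  sum (Finset.HasAntidiagonal.antidiagonal n) fun i _ => (hx.mon hy hz i.1 i.2).smul (c i.1 i.2)

end Rep

variable (k)

/-- The cocycle `a* ⊗ (ba)* + (ab)* ⊗ a*`. -/
def zeta : Bar (augA k) := letter k 0 * letter k 3 + letter k 2 * letter k 0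

theorem barSign_letter (i : Fin 5) : barSign (augA k) (letter k i) = -letter k i := by
  simp [barSign, letter]

theorem delta_zeta : delta (augA k) (zeta k) = 0 := by
  simp [zeta, delta_mul, barSign_letter, mul_assoc]

/-- The classes `x, y, z` in `E(A)`. -/
def yGen : Fin 3 → YonedaRing (augA k) :=
  ![(exists_rep (delta_letter_zero k)).choose, (exists_rep (delta_letter_one k)).choose,
    (exists_rep (delta_zeta k)).choose]

theorem rep_x : Rep (letter k 0) (yGen k 0) := (exists_rep (delta_letter_zero k)).choose_spec

theorem rep_y : Rep (letter k 1) (yGen k 1) := (exists_rep (delta_letter_one k)).choose_spec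

theorem rep_z : Rep (zeta k) (yGen k 2) := (exists_rep (delta_zeta k)).choose_spec

/-- In the cubic relations $\delta(l_4l_0)$ contributes an unwanted $l_3l_1l_0$, which
$\delta(l_3l_3)$ trades for the missing $l_1l_0l_3$. Likewise $l_2l_2$ corrects $l_0l_4$. -/
theorem yGen_isERel : IsERel (yGen k 0) (yGen k 1) (yGen k 2) where
  xy := ((rep_x k).mul (rep_y k)).eq_of_sub_eq_delta .zero (-letter k 2) (by simp)
  yx := ((rep_y k).mul (rep_x k)).eq_of_sub_eq_delta .zero (-letter k 3) (by simp)
  zx := ((rep_z k).mul (rep_x k)).eq_of_sub_eq_delta ((rep_y k).mul (rep_z k)).neg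
    (-(letter k 4 * letter k 0) - letter k 3 * letter k 3) (by
      simp only [zeta, map_sub, map_neg, delta_mul, barSign_letter, delta_letter_zero,
        delta_letter_three, delta_letter_four]
      noncomm_ring)
  xz := ((rep_x k).mul (rep_z k)).eq_of_sub_eq_delta ((rep_z k).mul (rep_y k)).neg
    (letter k 0 * letter k 4 + letter k 2 * letter k 2) (by
      simp only [zeta, map_add, delta_mul, barSign_letter, delta_letter_zero,
        delta_letter_two, delta_letter_four]
      noncomm_ring)

end Representatives

/-! ### Monomials form a basis in each degree of $E(A)$ -/

section Cohomology

variable {k : Type u} [Field k]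

theorem decompose_delta (w : Bar (augA k)) (n : ℕ) :
    (DirectSum.decompose (homog k) (delta (augA k) w) (n + 1) : Bar (augA k)) =
      delta (augA k) (DirectSum.decompose (homog k) w n) := by
  induction w using DirectSum.Decomposition.inductionOn (homog k) with
  | zero => simp
  | @homogeneous i w =>
    by_cases h : i = n
    · subst h
      rw [DirectSum.decompose_of_mem_same _ (delta_mem w.2), DirectSum.decompose_of_mem_same _ w.2]
    · rw [DirectSum.decompose_of_mem_ne _ (delta_mem w.2) (by omega),
        DirectSum.decompose_of_mem_ne _ w.2 h, map_zero]
  | add v w hv hw => simp [DirectSum.decompose_add, hv, hw]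

theorem decompose_delta_zero (w : Bar (augA k)) :
    (DirectSum.decompose (homog k) (delta (augA k) w) 0 : Bar (augA k)) = 0 := by
  induction w using DirectSum.Decomposition.inductionOn (homog k) with
  | zero => simp
  | homogeneous w => exact DirectSum.decompose_of_mem_ne _ (delta_mem w.2) (by omega)
  | add v w hv hw => simp [DirectSum.decompose_add, hv, hw]

theorem exists_mem_delta_eq {n : ℕ} {t : Bar (augA k)} (ht : t ∈ homog k (n + 1))
    (h : ∃ w, delta (augA k) w = t) : ∃ u ∈ homog k n, delta (augA k) u = t := by
  obtain ⟨w, rfl⟩ := h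
  refine ⟨_, (DirectSum.decompose (homog k) w n).2, ?_⟩
  rw [← decompose_delta, DirectSum.decompose_of_mem_same _ ht]

theorem eq_zero_of_mem_zero {t : Bar (augA k)} (ht : t ∈ homog k 0)
    (h : ∃ w, delta (augA k) w = t) : t = 0 := by
  obtain ⟨w, rfl⟩ := h
  rw [← DirectSum.decompose_of_mem_same (homog k) ht, decompose_delta_zero]

/-- Stating the degree of $u$ through its products avoids degree $n-1$; for $n=0$ an exact cochain
vanishes and $u=0$ serves. -/
theorem exists_mul_mem_delta_eq {n : ℕ} {t : Bar (augA k)} (ht : t ∈ homog k n)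
    (h : ∃ w, delta (augA k) w = t) :
    ∃ u, delta (augA k) u = t ∧ ∀ v ∈ homog k 1, u * v ∈ homog k n := by
  rcases n with _ | n
  · exact ⟨0, by rw [eq_zero_of_mem_zero ht h, map_zero], fun v _ => by simp⟩
  · obtain ⟨u, hu, rfl⟩ := exists_mem_delta_eq ht h
    exact ⟨u, rfl, fun v hv => mul_mem_homog hu hv⟩

theorem zeta_mem : zeta k ∈ homog k 2 :=
  add_mem (mul_mem_homog (letter_mem 0) (letter_mem 3))
    (mul_mem_homog (letter_mem 2) (letter_mem 0))

theorem pow_mem_homog {m : ℕ} {t : Bar (augA k)} (ht : t ∈ homog k m) (n : ℕ) :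
    t ^ n ∈ homog k (n * m) := by
  induction n with
  | zero => rw [pow_zero, zero_mul, homog, pow_zero]; exact Submodule.one_le.mp le_rfl
  | succ n ih => rw [pow_succ, Nat.succ_mul]; exact mul_mem_homog ih ht

theorem mon_mem_homog (p q : ℕ) :
    mon (letter k 0) (letter k 1) (zeta k) p q ∈ homog k (p + q) := by
  have h := mul_mem_homog (mul_mem_homog (pow_mem_homog (zeta_mem (k := k)) (min p q))
    (pow_mem_homog (letter_mem (k := k) 0) (p - q))) (pow_mem_homog (letter_mem (k := k) 1) (q - p))
  rwa [show min p q * 2 + (p - q) * 1 + (q - p) * 1 = p + q by omega] at h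

variable (k)

/-- The combinations of monomials in `x, y, z` as cocycles. -/
abbrev cocycleSum (n : ℕ) : (ℕ → ℕ → k) →ₗ[k] Bar (augA k) :=
  monSum (letter k 0) (letter k 1) (zeta k) n

/-- The combinations of monomials in `x, y, z` in `E(A)`. -/
abbrev classSum (n : ℕ) : (ℕ → ℕ → k) →ₗ[k] YonedaRing (augA k) :=
  monSum (yGen k 0) (yGen k 1) (yGen k 2) n

/-- The span of the monomials of degree `n` in `E(A)`. -/
abbrev classSpan (n : ℕ) : Submodule k (YonedaRing (augA k)) :=
  monSpan k (yGen k 0) (yGen k 1) (yGen k 2) n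

variable {k}

theorem rep_cocycleSum (n : ℕ) (c : ℕ → ℕ → k) : Rep (cocycleSum k n c) (classSum k n c) :=
  (rep_x k).monSum (rep_y k) (rep_z k) n c

theorem cocycleSum_mem (n : ℕ) (c : ℕ → ℕ → k) : cocycleSum k n c ∈ homog k n := by
  rw [monSum_apply]
  refine Submodule.sum_mem _ fun i hi => Submodule.smul_mem _ _ ?_
  rw [← Finset.HasAntidiagonal.mem_antidiagonal.mp hi]
  exact mon_mem_homog _ _

variable (k)

/-- The monomials of degree `n` are linearly independent in `E(A)`. -/
def Independent (n : ℕ) : Prop :=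
  ∀ c : ℕ → ℕ → k, classSum k n c = 0 → ∀ p q, p + q = n → c p q = 0

/-- The monomials of degree `n` span the classes of the cocycles of degree `n`. -/
def Spanning (n : ℕ) : Prop :=
  ∀ t ∈ homog k n, ∀ e, Rep t e → e ∈ classSpan k n

variable {k}

/-- Multiplication by $x$ carries the monomials with $q\le p$ to distinct monomials and kills the
others. -/
theorem Independent.of_mul_x {n : ℕ} (h : Independent k (n + 1)) {c : ℕ → ℕ → k}
    (hc : classSum k n c * yGen k 0 = 0) {p q : ℕ} (hpq : p + q = n) (hle : q ≤ p) :
    c p q = 0 := by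
  rw [(yGen_isERel k).monSum_mul_x] at hc
  have := h _ hc (p + 1) q (by omega)
  rwa [if_pos (by omega)] at this

theorem Independent.of_mul_y {n : ℕ} (h : Independent k (n + 1)) {c : ℕ → ℕ → k}
    (hc : classSum k n c * yGen k 1 = 0) {p q : ℕ} (hpq : p + q = n) (hle : p ≤ q) :
    c p q = 0 := by
  rw [(yGen_isERel k).monSum_mul_y] at hc
  have := h _ hc p (q + 1) (by omega)
  rwa [if_pos (by omega)] at this

theorem exists_rep_classSum {n : ℕ} (hS : Spanning k n) {t : Bar (augA k)} (ht : t ∈ homog k n)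
    (hδ : delta (augA k) t = 0) : ∃ c, Rep t (classSum k n c) := by
  obtain ⟨e, he⟩ := exists_rep hδ
  obtain ⟨c, rfl⟩ := hS t ht e he
  exact ⟨c, he⟩

/-- Since $[t]y=0$, only monomials with $p>q$ survive in $[t]$, and these end in $x$. The factor $r$
has degree $m-1$, or is $0$ when $m=0$, so its degree is recorded through products. -/
theorem exists_eq_mul_x_add_delta {m : ℕ} (hS : Spanning k m) (hI : Independent k (m + 1))
    {t : Bar (augA k)} (ht : t ∈ homog k m) (hδ : delta (augA k) t = 0)
    (hw : ∃ w, delta (augA k) w = t * letter k 1) :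
    ∃ r u ρ, t = r * letter k 0 + delta (augA k) u ∧ Rep r ρ ∧
      ρ * yGen k 2 ∈ classSpan k (m + 1) ∧ (∀ v ∈ homog k 2, r * v ∈ homog k (m + 1)) ∧
      ∀ v ∈ homog k 1, u * v ∈ homog k m := by
  obtain ⟨c, hc⟩ := exists_rep_classSum hS ht hδ
  have hc0 : ∀ p q, p + q = m → p ≤ q → c p q = 0 := fun p q hpq hle =>
    hI.of_mul_y ((hc.mul (rep_y k)).eq_zero_iff.mpr hw) hpq hle
  rcases m with _ | m
  · have h0 : classSum k 0 c = 0 := monSum_eq_zero _ _ _ fun p q hpq => hc0 p q hpq (by omega)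
    obtain ⟨u, hu, hu'⟩ := exists_mul_mem_delta_eq ht (hc.eq_zero_iff.mp h0)
    exact ⟨0, u, 0, by simp [hu], .zero, by simp, fun v _ => by simp, hu'⟩
  · let d : ℕ → ℕ → k := fun p q => if q ≤ p then c (p + 1) q else 0
    have hd : classSum k m d * yGen k 0 = classSum k (m + 1) c := by
      rw [(yGen_isERel k).monSum_mul_x]
      refine monSum_congr _ _ _ fun p q hpq => ?_
      split_ifs with h
      · simp only [d]
        rw [if_pos (by omega), Nat.sub_add_cancel (by omega)]
      · exact (hc0 p q hpq (by omega)).symm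
    have hr := rep_cocycleSum m d
    have hmem : t - cocycleSum k m d * letter k 0 ∈ homog k (m + 1) :=
      sub_mem ht (mul_mem_homog (cocycleSum_mem m d) (letter_mem 0))
    obtain ⟨u, hu, hu'⟩ := exists_mul_mem_delta_eq hmem
      ((hc.sub (hr.mul (rep_x k))).eq_zero_iff.mp (by rw [hd, sub_self]))
    exact ⟨_, u, _, by rw [hu]; abel, hr, (yGen_isERel k).mul_z_mem ⟨d, rfl⟩,
      fun v hv => mul_mem_homog (m := m) (n := 2) (cocycleSum_mem m d) hv, hu'⟩

theorem exists_eq_mul_y_add_delta {m : ℕ} (hS : Spanning k m) (hI : Independent k (m + 1))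
    {t : Bar (augA k)} (ht : t ∈ homog k m) (hδ : delta (augA k) t = 0)
    (hw : ∃ w, delta (augA k) w = t * letter k 0) :
    ∃ r u ρ, t = r * letter k 1 + delta (augA k) u ∧ Rep r ρ ∧
      ρ * yGen k 2 ∈ classSpan k (m + 1) ∧ (∀ v ∈ homog k 2, r * v ∈ homog k (m + 1)) ∧
      ∀ v ∈ homog k 1, u * v ∈ homog k m := by
  obtain ⟨c, hc⟩ := exists_rep_classSum hS ht hδ
  have hc0 : ∀ p q, p + q = m → q ≤ p → c p q = 0 := fun p q hpq hle =>
    hI.of_mul_x ((hc.mul (rep_x k)).eq_zero_iff.mpr hw) hpq hle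
  rcases m with _ | m
  · have h0 : classSum k 0 c = 0 := monSum_eq_zero _ _ _ fun p q hpq => hc0 p q hpq (by omega)
    obtain ⟨u, hu, hu'⟩ := exists_mul_mem_delta_eq ht (hc.eq_zero_iff.mp h0)
    exact ⟨0, u, 0, by simp [hu], .zero, by simp, fun v _ => by simp, hu'⟩
  · let d : ℕ → ℕ → k := fun p q => if p ≤ q then c p (q + 1) else 0
    have hd : classSum k m d * yGen k 1 = classSum k (m + 1) c := by
      rw [(yGen_isERel k).monSum_mul_y]
      refine monSum_congr _ _ _ fun p q hpq => ?_
      split_ifs with h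
      · simp only [d]
        rw [if_pos (by omega), Nat.sub_add_cancel (by omega)]
      · exact (hc0 p q hpq (by omega)).symm
    have hr := rep_cocycleSum m d
    have hmem : t - cocycleSum k m d * letter k 1 ∈ homog k (m + 1) :=
      sub_mem ht (mul_mem_homog (cocycleSum_mem m d) (letter_mem 1))
    obtain ⟨u, hu, hu'⟩ := exists_mul_mem_delta_eq hmem
      ((hc.sub (hr.mul (rep_y k))).eq_zero_iff.mp (by rw [hd, sub_self]))
    exact ⟨_, u, _, by rw [hu]; abel, hr, (yGen_isERel k).mul_z_mem ⟨d, rfl⟩,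
      fun v hv => mul_mem_homog (m := m) (n := 2) (cocycleSum_mem m d) hv, hu'⟩

theorem exists_delta_eq_of_barSign_mul {m : ℕ} {s v w : Bar (augA k)} (hs : s ∈ homog k m)
    (h : delta (augA k) w - barSign (augA k) s * v = 0) : ∃ w, delta (augA k) w = s * v := by
  refine ⟨(-1 : k) ^ m • w, ?_⟩
  rw [map_smul, sub_eq_zero.mp h, barSign_of_mem hs, smul_mul_assoc, smul_smul, ← mul_pow]
  simp

/-- The cocycle `b* ⊗ (ab)* + (ba)* ⊗ b*`, cohomologous to `-zeta`. -/
theorem rep_neg_z : Rep (letter k 1 * letter k 2 + letter k 3 * letter k 1) (-yGen k 2) := by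
  have h : letter k 1 * letter k 2 + letter k 3 * letter k 1 =
      -zeta k + delta (augA k) (-letter k 4) := by
    rw [map_neg, delta_letter_four, zeta]
    abel
  rw [h, ← add_zero (-yGen k 2)]
  exact (rep_z k).neg.add (.delta _)

theorem spanning_zero : Spanning k 0 := by
  intro t ht e he
  rw [homog, pow_zero, Submodule.mem_one] at ht
  obtain ⟨r, rfl⟩ := ht
  refine ⟨fun _ _ => r, ?_⟩
  rw [monSum_zero]
  refine Rep.unique (Rep.smul r .one) ?_
  rwa [← Algebra.algebraMap_eq_smul_one]

/-- The cocycles in which only the generators dual to `a` and `b` occur on the right. -/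
theorem mem_classSpan_of_coef {m : ℕ} (hS : Spanning k m) {t : Bar (augA k)}
    (ht : t ∈ homog k (m + 1)) {e : YonedaRing (augA k)} (he : Rep t e) (h₂ : coef k 2 t = 0)
    (h₃ : coef k 3 t = 0) (h₄ : coef k 4 t = 0) : e ∈ classSpan k (m + 1) := by
  have h := he.delta_eq_zero
  have h0 := coef_zero_delta k t
  have h1 := coef_one_delta k t
  rw [h, map_zero, h₃, h₄] at h0
  rw [h, map_zero, h₂, h₄] at h1
  obtain ⟨c, hc⟩ := exists_rep_classSum hS (coef_mem 0 ht) (by simpa using h0.symm)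
  obtain ⟨d, hd⟩ := exists_rep_classSum hS (coef_mem 1 ht) (by simpa using h1.symm)
  have hsum := sum_coef_mul_letter ht
  simp only [Fin.sum_univ_five, h₂, h₃, h₄, zero_mul, add_zero] at hsum
  have := (hc.mul (rep_x k)).add (hd.mul (rep_y k))
  rw [hsum] at this
  rw [he.unique this]
  exact add_mem ((yGen_isERel k).mul_x_mem ⟨c, rfl⟩) ((yGen_isERel k).mul_y_mem ⟨d, rfl⟩)

/-- Now $t_2,t_3$ are cocycles with $[t_3]y=0=[t_2]x$, hence cohomologous to $r\,l_0$ and $r'l_1$.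
These are the coefficients of $rz$ at $l_3$ and of $-r'z$ at $l_2$, for suitable representatives of
$\pm z$, so subtracting such products leaves only $l_0,l_1$. -/
theorem mem_classSpan_of_coef_four {m : ℕ} (hS : Spanning k m) (hI : Independent k (m + 1))
    {t : Bar (augA k)} (ht : t ∈ homog k (m + 1)) {e : YonedaRing (augA k)} (he : Rep t e)
    (h₄ : coef k 4 t = 0) : e ∈ classSpan k (m + 1) := by
  have h := he.delta_eq_zero
  have h0 := coef_zero_delta k t
  have h1 := coef_one_delta k t
  have h2 := coef_two_delta k t
  have h3 := coef_three_delta k t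
  rw [h, map_zero, h₄, map_zero, zero_mul, sub_zero] at h0 h1 h2 h3
  obtain ⟨r, u, ρ, hr, hρ, hρz, hrv, huv⟩ := exists_eq_mul_x_add_delta hS hI (coef_mem 3 ht)
    h3.symm (exists_delta_eq_of_barSign_mul (coef_mem 3 ht) h0.symm)
  obtain ⟨r', u', ρ', hr', hρ', hρz', hrv', huv'⟩ := exists_eq_mul_y_add_delta hS hI
    (coef_mem 2 ht) h2.symm (exists_delta_eq_of_barSign_mul (coef_mem 2 ht) h1.symm)
  have key := mem_classSpan_of_coef hS (t := t - delta (augA k) (u * letter k 3) - r * zeta k -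
      delta (augA k) (u' * letter k 2) -
      r' * (letter k 1 * letter k 2 + letter k 3 * letter k 1))
    (sub_mem (sub_mem (sub_mem (sub_mem ht (delta_mem (huv _ (letter_mem 3))))
      (hrv _ zeta_mem)) (delta_mem (huv' _ (letter_mem 2))))
      (hrv' _ (add_mem (mul_mem_homog (letter_mem 1) (letter_mem 2))
        (mul_mem_homog (letter_mem 3) (letter_mem 1)))))
    ((((he.sub (.delta _)).sub (hρ.mul (rep_z k))).sub (.delta _)).sub (hρ'.mul rep_neg_z))
    (by simp [delta_mul_letter, zeta, mul_add, ← mul_assoc, coef_mul_letter, hr'])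
    (by simp [delta_mul_letter, zeta, mul_add, ← mul_assoc, coef_mul_letter, hr])
    (by simp [delta_mul_letter, zeta, mul_add, ← mul_assoc, coef_mul_letter, h₄])
  have he' : e = (e - 0 - ρ * yGen k 2 - 0 - ρ' * -yGen k 2) + ρ * yGen k 2 - ρ' * yGen k 2 := by
    rw [mul_neg]; abel
  rw [he']
  exact sub_mem (add_mem key hρz) hρz'

/-- Both $x$ and $y$ annihilate $[t_4]$, while each monomial survives one of the two. So $t_4=\delta
u$, and $\delta(u\,l_4)$ removes it. -/
theorem Spanning.succ {m : ℕ} (hS : Spanning k m) (hI : Independent k (m + 1)) :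
    Spanning k (m + 1) := by
  intro t ht e he
  have h := he.delta_eq_zero
  have h2 := coef_two_delta k t
  have h3 := coef_three_delta k t
  have h4 := coef_four_delta k t
  rw [h, map_zero] at h2 h3 h4
  have hmem := coef_mem 4 ht
  obtain ⟨c, hc⟩ := exists_rep_classSum hS hmem h4.symm
  have hx := (hc.mul (rep_x k)).eq_zero_iff.mpr (exists_delta_eq_of_barSign_mul hmem h3.symm)
  have hy := (hc.mul (rep_y k)).eq_zero_iff.mpr (exists_delta_eq_of_barSign_mul hmem h2.symm)
  have h0 : classSum k m c = 0 := monSum_eq_zero _ _ _ fun p q hpq =>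
    (le_total q p).elim (hI.of_mul_x hx hpq) (hI.of_mul_y hy hpq)
  obtain ⟨u, hu, huv⟩ := exists_mul_mem_delta_eq hmem (hc.eq_zero_iff.mp h0)
  have key := mem_classSpan_of_coef_four hS hI (t := t - delta (augA k) (u * letter k 4))
    (sub_mem ht (delta_mem (huv _ (letter_mem 4)))) (he.sub (.delta _))
    (by simp [delta_mul_letter, mul_add, ← mul_assoc, coef_mul_letter, hu])
  rwa [sub_zero] at key

theorem independent_zero : Independent k 0 := by
  intro c hc p q hpq
  obtain ⟨rfl, rfl⟩ : p = 0 ∧ q = 0 := by omega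
  have h := (rep_cocycleSum 0 c).eq_zero_iff.mp hc
  have h0 := eq_zero_of_mem_zero (cocycleSum_mem 0 c) h
  rw [monSum_zero, ← Algebra.algebraMap_eq_smul_one] at h0
  simpa using congrArg TensorAlgebra.algebraMapInv h0

theorem independent_one : Independent k 1 := by
  intro c hc p q hpq
  obtain ⟨s, hs, h⟩ := exists_mem_delta_eq (cocycleSum_mem 1 c)
    ((rep_cocycleSum 1 c).eq_zero_iff.mp hc)
  rw [homog, pow_zero, Submodule.mem_one] at hs
  obtain ⟨r, rfl⟩ := hs
  rw [delta_algebraMap, monSum_one] at h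
  have hl : ∀ i j, coef k i (letter k j) = if j = i then 1 else 0 := fun i j => by
    rw [← one_mul (letter k j), coef_mul_letter]
  have h0 := congrArg (fun t => TensorAlgebra.algebraMapInv (coef k 0 t)) h
  have h1 := congrArg (fun t => TensorAlgebra.algebraMapInv (coef k 1 t)) h
  simp [hl] at h0 h1
  obtain ⟨rfl, rfl⟩ | ⟨rfl, rfl⟩ : (p = 0 ∧ q = 1) ∨ (p = 1 ∧ q = 0) := by omega
  exacts [h1.symm, h0.symm]

/-- The coefficients at $l_0$ and $l_1$ give $[c]\pm[s_3]y=0$ and $[d]\pm[s_2]x=0$. Products with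
$y$ involve only $p<q$ and products with $x$ only $q<p$, so they cannot cancel the terms in
question. -/
theorem Independent.eq_zero_of_delta_eq {n : ℕ} (hS : Spanning k n) (hI : Independent k (n + 1))
    {s : Bar (augA k)} (hs : s ∈ homog k (n + 1)) {c d : ℕ → ℕ → k}
    (h : delta (augA k) s = cocycleSum k (n + 1) c * letter k 0 +
      cocycleSum k (n + 1) d * letter k 1) (h₄ : coef k 4 s = 0) :
    (∀ p q, p + q = n + 1 → q ≤ p → c p q = 0) ∧ ∀ p q, p + q = n + 1 → p ≤ q → d p q = 0 := by
  have h0 := coef_zero_delta k s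
  have h1 := coef_one_delta k s
  have h2 := coef_two_delta k s
  have h3 := coef_three_delta k s
  rw [h, h₄] at h0 h1 h2 h3
  simp [coef_mul_letter] at h0 h1 h2 h3
  rw [barSign_of_mem (coef_mem _ hs)] at h0 h1
  obtain ⟨e₃, he₃⟩ := exists_rep_classSum hS (coef_mem 3 hs) h3.symm
  obtain ⟨e₂, he₂⟩ := exists_rep_classSum hS (coef_mem 2 hs) h2.symm
  constructor
  · intro p q hpq hle
    have hz : classSum k (n + 1) c + ((-1 : k) ^ n • classSum k n e₃) * yGen k 1 = 0 :=
      ((rep_cocycleSum (n + 1) c).add ((he₃.smul _).mul (rep_y k))).eq_zero_iff.mpr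
        ⟨coef k 0 s, by rw [h0, sub_add_cancel]⟩
    rw [← map_smul, (yGen_isERel k).monSum_mul_y, ← map_add] at hz
    have := hI _ hz p q hpq
    rwa [Pi.add_apply, Pi.add_apply, if_neg hle.not_gt, add_zero] at this
  · intro p q hpq hle
    have hz : classSum k (n + 1) d + ((-1 : k) ^ n • classSum k n e₂) * yGen k 0 = 0 :=
      ((rep_cocycleSum (n + 1) d).add ((he₂.smul _).mul (rep_x k))).eq_zero_iff.mpr
        ⟨coef k 1 s, by rw [h1, sub_add_cancel]⟩
    rw [← map_smul, (yGen_isERel k).monSum_mul_x, ← map_add] at hz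
    have := hI _ hz p q hpq
    rwa [Pi.add_apply, Pi.add_apply, if_neg hle.not_gt, add_zero] at this

/-- If $c_0x+c_1y+c_2z$ is $\delta s$, the coefficients at $l_2,l_3$ give $[s_4]y=0$ and
$(c_2\pm[s_4])x=0$. On the diagonal both apply, and $c_2$ lives there, so $c_2=0$ and then
$[s_4]=0$. Removing $s_4$ leaves the case of $c_0,c_1$. -/
theorem Independent.add_two {n : ℕ} (hS : Spanning k n) (hI : Independent k (n + 1)) :
    Independent k (n + 2) := by
  intro c hc
  obtain ⟨s, hs, h⟩ := exists_mem_delta_eq (cocycleSum_mem (n + 2) c)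
    ((rep_cocycleSum (n + 2) c).eq_zero_iff.mp hc)
  let c₀ : ℕ → ℕ → k := fun p q => if q ≤ p then c (p + 1) q else 0
  let c₁ : ℕ → ℕ → k := fun p q => if p ≤ q then c p (q + 1) else 0
  let c₂ : ℕ → ℕ → k := fun p q => if p = q then c (p + 1) (q + 1) else 0
  have hsum : cocycleSum k (n + 2) c = cocycleSum k (n + 1) c₀ * letter k 0 +
      cocycleSum k (n + 1) c₁ * letter k 1 + cocycleSum k n c₂ * zeta k :=
    monSum_add_two _ _ _ n c
  have h2 := coef_two_delta k s
  have h3 := coef_three_delta k s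
  have h4 := coef_four_delta k s
  rw [h, hsum] at h2 h3 h4
  simp only [map_add, zeta, mul_add, ← mul_assoc, coef_mul_letter] at h2 h3 h4
  simp at h2 h3 h4
  have hmem := coef_mem 4 hs
  obtain ⟨d, hd⟩ := exists_rep_classSum hS hmem h4.symm
  have hy := (hd.mul (rep_y k)).eq_zero_iff.mpr (exists_delta_eq_of_barSign_mul hmem h2.symm)
  have hx : classSum k n (c₂ + (-1 : k) ^ n • d) * yGen k 0 = 0 := by
    rw [map_add, map_smul]
    refine ((((rep_cocycleSum n c₂).add (hd.smul _)).mul (rep_x k)).eq_zero_iff).mpr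
      ⟨coef k 3 s, ?_⟩
    rw [add_mul, h3, ← barSign_of_mem hmem, sub_add_cancel]
  have hdiag : ∀ p q, p + q = n → p = q → c₂ p q = 0 := by
    intro p q hpq hp
    have := hI.of_mul_x hx hpq hp.ge
    simpa [hI.of_mul_y hy hpq hp.le] using this
  have hc₂ : ∀ p q, p + q = n → c₂ p q = 0 := by
    intro p q hpq
    by_cases hp : p = q
    · exact hdiag p q hpq hp
    · exact if_neg hp
  have hd0 : classSum k n d = 0 := monSum_eq_zero _ _ _ fun p q hpq => by
    rcases le_total p q with hle | hle
    · exact hI.of_mul_y hy hpq hle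
    · have := hI.of_mul_x hx hpq hle
      simpa [hc₂ p q hpq] using this
  obtain ⟨u, hu, huv⟩ := exists_mul_mem_delta_eq hmem (hd.eq_zero_iff.mp hd0)
  have hs' : s - delta (augA k) (u * letter k 4) ∈ homog k (n + 1) :=
    sub_mem hs (delta_mem (huv _ (letter_mem 4)))
  have h' : delta (augA k) (s - delta (augA k) (u * letter k 4)) =
      cocycleSum k (n + 1) c₀ * letter k 0 + cocycleSum k (n + 1) c₁ * letter k 1 := by
    rw [map_sub, delta_delta, sub_zero, h, hsum, monSum_eq_zero _ _ _ hc₂, zero_mul, add_zero]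
  have hs₄ : coef k 4 (s - delta (augA k) (u * letter k 4)) = 0 := by
    simp [delta_mul_letter, mul_add, ← mul_assoc, coef_mul_letter, hu]
  generalize s - delta (augA k) (u * letter k 4) = s' at hs' h' hs₄
  obtain ⟨hc₀, hc₁⟩ := hI.eq_zero_of_delta_eq hS hs' h' hs₄
  intro p q hpq
  rcases lt_trichotomy p q with hlt | rfl | hlt
  · obtain ⟨q, rfl⟩ : ∃ q', q = q' + 1 := ⟨q - 1, by omega⟩
    have := hc₁ p q (by omega) (by omega)
    simpa [c₁, show p ≤ q by omega] using this
  · obtain ⟨p, rfl⟩ : ∃ p', p = p' + 1 := ⟨p - 1, by omega⟩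
    simpa [c₂] using hc₂ p p (by omega)
  · obtain ⟨p, rfl⟩ : ∃ p', p = p' + 1 := ⟨p - 1, by omega⟩
    have := hc₀ p q (by omega) (by omega)
    simpa [c₀, show q ≤ p by omega] using this

theorem independent_succ_and_spanning (n : ℕ) : Independent k (n + 1) ∧ Spanning k n := by
  induction n with
  | zero => exact ⟨independent_one, spanning_zero⟩
  | succ n ih => exact ⟨Independent.add_two ih.2 ih.1, ih.2.succ ih.1⟩

theorem spanning (n : ℕ) : Spanning k n := (independent_succ_and_spanning n).2

theorem independent (n : ℕ) : Independent k n := by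
  rcases n with _ | n
  · exact independent_zero
  · exact (independent_succ_and_spanning n).1

end Cohomology

/-! ### The presented algebra is $E(A)$ -/

section Presentation

variable (k : Type u) [Field k]

theorem eGen_isERel : IsERel (eGen k 0) (eGen k 1) (eGen k 2) where
  xy := by simpa [eGen] using RingQuot.mkAlgHom_rel k (ERel.xy (k := k))
  yx := by simpa [eGen] using RingQuot.mkAlgHom_rel k (ERel.yx (k := k))
  zx := eq_neg_of_add_eq_zero_left
    (by simpa [eGen] using RingQuot.mkAlgHom_rel k (ERel.zx (k := k)))
  xz := eq_neg_of_add_eq_zero_left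
    (by simpa [eGen] using RingQuot.mkAlgHom_rel k (ERel.xz (k := k)))

theorem prod_map_eGen_mem (l : List (Fin 3)) :
    (l.map (eGen k)).prod ∈ monSpan k (eGen k 0) (eGen k 1) (eGen k 2) (l.map eWeight).sum := by
  induction l using List.reverseRecOn with
  | nil => simpa [mon_zero_zero] using mon_mem_monSpan (k := k) (eGen k 0) (eGen k 1) (eGen k 2) 0 0
  | append_singleton l i ih =>
    rw [List.map_append, List.map_append, List.prod_append, List.sum_append, List.map_singleton,
      List.map_singleton, List.prod_singleton, List.sum_singleton]
    fin_cases i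
    exacts [(eGen_isERel k).mul_x_mem ih, (eGen_isERel k).mul_y_mem ih,
      (eGen_isERel k).mul_z_mem ih]

theorem mon_mem_eDegree (p q : ℕ) :
    mon (eGen k 0) (eGen k 1) (eGen k 2) p q ∈ eDegree k (p + q) := by
  refine Submodule.subset_span ⟨List.replicate (min p q) 2 ++ List.replicate (p - q) 0 ++
    List.replicate (q - p) 1, ?_, by simp [mon, mul_assoc]⟩
  simp [eWeight]
  omega

theorem eDegree_eq_monSpan (n : ℕ) :
    eDegree k n = monSpan k (eGen k 0) (eGen k 1) (eGen k 2) n := by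
  apply le_antisymm
  · rw [eDegree, Submodule.span_le]
    rintro _ ⟨l, rfl, rfl⟩
    exact prod_map_eGen_mem k l
  · rintro _ ⟨c, rfl⟩
    rw [monSum_apply]
    refine Submodule.sum_mem _ fun i hi => Submodule.smul_mem _ _ ?_
    rw [← Finset.HasAntidiagonal.mem_antidiagonal.mp hi]
    exact mon_mem_eDegree k _ _

theorem iSup_eDegree : ⨆ n, eDegree k n = ⊤ := by
  have hl : ∀ l : List (Fin 3), (l.map (eGen k)).prod ∈ ⨆ n, eDegree k n := fun l =>
    Submodule.mem_iSup_of_mem _ (Submodule.subset_span ⟨l, rfl, rfl⟩)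
  have hw : ∀ w : FreeAlgebra k (Fin 3), ∀ x ∈ ⨆ n, eDegree k n,
      x * RingQuot.mkAlgHom k (ERel k) w ∈ ⨆ n, eDegree k n := by
    intro w
    induction w using FreeAlgebra.induction with
    | grade0 r =>
      intro x hx
      rw [AlgHom.commutes, ← Algebra.commutes, ← Algebra.smul_def]
      exact Submodule.smul_mem _ r hx
    | grade1 i =>
      intro x hx
      induction hx using Submodule.iSup_induction' with
      | mem n x hx =>
        induction hx using Submodule.span_induction with
        | mem x h =>
          obtain ⟨l, _, rfl⟩ := h
          simpa [eGen] using hl (l ++ [i])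
        | zero => simp
        | add x y _ _ hx hy => rw [add_mul]; exact add_mem hx hy
        | smul r x _ hx => rw [smul_mul_assoc]; exact Submodule.smul_mem _ r hx
      | zero => simp
      | add x y _ _ hx hy => rw [add_mul]; exact add_mem hx hy
    | mul u v hu hv => intro x hx; rw [map_mul, ← mul_assoc]; exact hv _ (hu x hx)
    | add u v hu hv => intro x hx; rw [map_add, mul_add]; exact add_mem (hu x hx) (hv x hx)
  refine Submodule.eq_top_iff'.mpr fun x => ?_
  obtain ⟨w, rfl⟩ := RingQuot.mkAlgHom_surjective k (ERel k) x
  simpa using hw w 1 (hl [])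

/-- The algebra map `k⟨x, y, z | xy, yx, zx + yz, xz + zy⟩ → E(A)`. -/
def toYoneda : EPres k →ₐ[k] YonedaRing (augA k) :=
  RingQuot.liftAlgHom k ⟨FreeAlgebra.lift k (yGen k), fun x y h => by
    have hy := yGen_isERel k
    cases h with
    | xy => simp [hy.xy]
    | yx => simp [hy.yx]
    | zx => simp [hy.zx]
    | xz => simp [hy.xz]⟩

theorem toYoneda_eGen (i : Fin 3) : toYoneda k (eGen k i) = yGen k i := by
  simp [toYoneda, eGen]

theorem map_eDegree (n : ℕ) : (eDegree k n).map (toYoneda k).toLinearMap = classSpan k n := by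
  rw [eDegree_eq_monSpan, map_monSpan, toYoneda_eGen, toYoneda_eGen, toYoneda_eGen]

theorem yonedaDegree_eq (n : ℕ) : yonedaDegree (augA k) n = classSpan k n := by
  apply le_antisymm
  · rintro _ ⟨t, ht, rfl⟩
    exact spanning n t.1 ht _ ⟨t, rfl, rfl⟩
  · rintro _ ⟨c, rfl⟩
    obtain ⟨t, ht, hc⟩ := rep_cocycleSum (k := k) n c
    refine ⟨t, ?_, hc⟩
    change t.1 ∈ homog k n
    rw [ht]
    exact cocycleSum_mem n c

/-- Since $\delta$ is homogeneous, a sum of cocycles of distinct degrees is exact only if every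
summand is; independence then applies degree by degree. -/
theorem toYoneda_injective : Function.Injective (toYoneda k) := by
  rw [injective_iff_map_eq_zero]
  intro x hx
  obtain ⟨f, hf, rfl⟩ := (Submodule.mem_iSup_iff_exists_finsupp _ x).mp
    (show x ∈ ⨆ n, eDegree k n by rw [iSup_eDegree]; trivial)
  have hc : ∀ n, ∃ c : ℕ → ℕ → k, monSum (eGen k 0) (eGen k 1) (eGen k 2) n c = f n := fun n => by
    have := hf n
    rwa [eDegree_eq_monSpan] at this
  choose c hc using hc
  have hrep : Rep (∑ n ∈ f.support, cocycleSum k n (c n)) 0 := by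
    rw [← hx, Finsupp.sum, map_sum]
    refine Rep.sum _ fun n _ => ?_
    rw [← hc n, map_monSum, toYoneda_eGen, toYoneda_eGen, toYoneda_eGen]
    exact rep_cocycleSum n (c n)
  obtain ⟨w, hw⟩ := hrep.eq_zero_iff.mp rfl
  refine Finset.sum_eq_zero fun n hn => ?_
  have hproj : (DirectSum.decompose (homog k) (delta (augA k) w) n : Bar (augA k)) =
      cocycleSum k n (c n) := by
    rw [hw, DirectSum.decompose_sum, DirectSum.sum_apply, AddSubmonoidClass.coe_finsetSum,
      Finset.sum_eq_single_of_mem n hn]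
    · exact DirectSum.decompose_of_mem_same _ (cocycleSum_mem n _)
    · intro m _ hm
      exact DirectSum.decompose_of_mem_ne _ (cocycleSum_mem m _) hm
  have hzero : classSum k n (c n) = 0 := by
    refine (rep_cocycleSum n (c n)).eq_zero_iff.mpr ?_
    rcases n with _ | n
    · exact ⟨0, by rw [map_zero, ← hproj, decompose_delta_zero]⟩
    · exact ⟨_, (decompose_delta w n).symm.trans hproj⟩
  rw [← hc n]
  exact monSum_eq_zero _ _ _ (independent n _ hzero)

theorem toYoneda_surjective : Function.Surjective (toYoneda k) := by
  classical
  intro e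
  obtain ⟨t, rfl⟩ := Ideal.Quotient.mkₐ_surjective k (coboundaries (augA k)) e
  have ht : Rep t.1 (Ideal.Quotient.mkₐ k (coboundaries (augA k)) t) := ⟨t, rfl, rfl⟩
  have hδ : ∀ n, delta (augA k) (DirectSum.decompose (homog k) t.1 n) = 0 := fun n => by
    rw [← decompose_delta, ht.delta_eq_zero]
    simp
  choose e he using fun n => exists_rep (hδ n)
  have hmem : ∀ n, e n ∈ (toYoneda k).range := fun n => by
    have := spanning n _ (DirectSum.decompose (homog k) t.1 n).2 _ (he n)
    rw [← map_eDegree] at this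
    obtain ⟨x, _, hx⟩ := this
    exact ⟨x, hx⟩
  have hsum := Rep.sum (DirectSum.decompose (homog k) t.1).support fun n _ => he n
  rw [DirectSum.sum_support_decompose] at hsum
  rw [ht.unique hsum]
  exact Subalgebra.sum_mem _ fun n _ => hmem n

/-- The isomorphism `E(A) ≃ k⟨x, y, z | xy, yx, zx + yz, xz + zy⟩`. -/
def yonedaEquiv : YonedaRing (augA k) ≃ₐ[k] EPres k :=
  (AlgEquiv.ofBijective (toYoneda k) ⟨toYoneda_injective k, toYoneda_surjective k⟩).symm

theorem map_yonedaEquiv (n : ℕ) :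
    (yonedaDegree (augA k) n).map (yonedaEquiv k).toLinearMap = eDegree k n := by
  rw [yonedaDegree_eq, ← map_eDegree, ← Submodule.map_comp]
  convert Submodule.map_id _
  refine LinearMap.ext fun x => ?_
  exact (AlgEquiv.ofBijective (toYoneda k)
    ⟨toYoneda_injective k, toYoneda_surjective k⟩).symm_apply_apply x

theorem finrank_yonedaDegree (n : ℕ) :
    Module.finrank k (yonedaDegree (augA k) n) = n + 1 := by
  -- On an antidiagonal the coefficients are functions of $p$ alone; values beyond $n$ are never
  -- read.
  let L : (Fin (n + 1) → k) →ₗ[k] (ℕ → ℕ → k) :=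
    { toFun := fun v p _ => if h : p < n + 1 then v ⟨p, h⟩ else 0
      map_add' := fun v w => by
        funext p q
        simp only [Pi.add_apply]
        split_ifs <;> simp
      map_smul' := fun r v => by
        funext p q
        simp only [Pi.smul_apply, RingHom.id_apply]
        split_ifs <;> simp }
  have hL : ∀ v (p : Fin (n + 1)) q, L v p q = v p := fun v p q => dif_pos p.2
  have hrange : LinearMap.range (classSum k n ∘ₗ L) = classSpan k n := by
    apply le_antisymm
    · exact LinearMap.range_comp_le_range _ _
    · rintro _ ⟨c, rfl⟩
      refine ⟨fun p => c p (n - p), monSum_congr _ _ _ fun p q hpq => ?_⟩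
      refine (hL _ ⟨p, by omega⟩ q).trans ?_
      simp [← hpq]
  have hinj : Function.Injective (classSum k n ∘ₗ L) := by
    rw [injective_iff_map_eq_zero]
    intro v hv
    funext p
    rw [← hL v p (n - p)]
    exact independent n _ hv _ _ (by omega)
  rw [yonedaDegree_eq, ← hrange, LinearMap.finrank_range_of_inj hinj]
  simp

end Presentation

end YonedaFK

end

theorem mainTheorem7 (k : Type*) [Field k] [CharZero k] :
    -- `A` is the subalgebra of `FK₃` generated by `a` and `b`
    (∃ j : YonedaFK.A k →ₐ[k] YonedaFK.FK k,
      j (YonedaFK.genA k) = YonedaFK.fkGen k 0 ∧ j (YonedaFK.genB k) = YonedaFK.fkGen k 1 ∧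
      Function.Injective j ∧
      j.range = Algebra.adjoin k {YonedaFK.fkGen k 0, YonedaFK.fkGen k 1}) ∧
    -- the isomorphism of graded algebras
    (∃ φ : YonedaFK.YonedaRing (YonedaFK.augA k) ≃ₐ[k] YonedaFK.EPres k,
      ∀ n : ℕ, (YonedaFK.yonedaDegree (YonedaFK.augA k) n).map φ.toLinearMap =
        YonedaFK.eDegree k n) ∧
    -- the dimensions, both of `E_n(A)` and of `Ext^n_A(k, k)`
    (∀ n : ℕ, Module.finrank k (YonedaFK.yonedaDegree (YonedaFK.augA k) n) = n + 1) ∧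
    (∀ n : ℕ, Module.finrank k (CategoryTheory.Abelian.Ext
      (YonedaFK.trivialModule (YonedaFK.augA k))
      (YonedaFK.trivialModule (YonedaFK.augA k)) n) = n + 1) ∧
    -- `C` is a double complex
    (∀ p q : ℕ, YonedaFK.dh k (p + 1) q ∘ₗ YonedaFK.dh k (p + 2) q = 0 ∧
      YonedaFK.dv k p (q + 1) ∘ₗ YonedaFK.dv k p (q + 2) = 0 ∧
      YonedaFK.dh k (p + 1) q ∘ₗ YonedaFK.dv k (p + 1) (q + 1) +
        YonedaFK.dv k p (q + 1) ∘ₗ YonedaFK.dh k (p + 1) (q + 1) = 0) ∧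
    -- its total complex is a free resolution of the trivial module `k`
    (Function.Surjective (fun w : Fin 1 → YonedaFK.A k => YonedaFK.augA k (w 0))) ∧
    (Function.Exact (YonedaFK.totD k 0)
      (fun w : Fin 1 → YonedaFK.A k => YonedaFK.augA k (w 0))) ∧
    (∀ n : ℕ, Function.Exact (YonedaFK.totD k (n + 1)) (YonedaFK.totD k n)) ∧
    -- the resolution is minimal
    (∀ (n : ℕ) (w : Fin (n + 2) → YonedaFK.A k) (p : Fin (n + 1)),
      YonedaFK.augA k (YonedaFK.totD k n w p) = 0) := by
  refine ⟨⟨YonedaFK.toFK k, YonedaFK.toFK_genA k, YonedaFK.toFK_genB k, YonedaFK.toFK_injective k,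
    YonedaFK.range_toFK k⟩, ⟨YonedaFK.yonedaEquiv k, YonedaFK.map_yonedaEquiv k⟩,
    YonedaFK.finrank_yonedaDegree k, YonedaFK.finrank_ext k, fun p q =>
      ⟨YonedaFK.dh_comp_dh k p q, YonedaFK.dv_comp_dv k p q, YonedaFK.dh_comp_dv_add k p q⟩,
    YonedaFK.augA_zero_surjective k, YonedaFK.totD_exact_zero k, YonedaFK.totD_exact_succ k,
    YonedaFK.augA_totD k⟩
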